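/- Let $\mathbb F$ be a field of odd characteristic $p$, let $n\ge 1$ and $q=p^n$. Let $H=H(2;(1,n);\Phi(1))$ be the Hamiltonian Lie algebra realized on the divided power algebra $\mathcal O(2;(1,n))$, which has basis $x^{(i)}y^{(j)}$ $(0\le i<p,\ 0\le j<q)$, product $x^{(i)}y^{(j)}x^{(k)}y^{(l)}=\binom{i+k}{i}\binom{j+l}{j}x^{(i+k)}y^{(j+l)}$ (zero out of range), and derivations $\partial_1x^{(i)}y^{(j)}=x^{(i-1)}y^{(j)}$, $\partial_2x^{(i)}y^{(j)}=x^{(i)}y^{(j-1)}$ (a term with a negative exponent being zero); the Lie bracket of $H$ is $$\{f,g\}=\partial_2(f)\partial_1(g)-\partial_1(f)\partial_2(g)+\bar x\,\bigl(\partial_2(f)g-f\partial_2(g)\bigr),\qquad \bar x=x^{(p-1)},\ \bar y=y^{(q-1)} .$$ Assume that $\sigma,\rho\in\mathbb F$ satisfy $\sigma\ne0$ and $\rho^p-\sigma^{p-1}\rho-1=0$. Put $e_0=y+\sigma^{p-1}\bar xy$ and $$e_{1-j,\alpha}=\sigma^{p-1}j\,\bar x y^{(j)}+\sum_{i=0}^{p-1}\alpha^i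 x^{(i)}y^{(j)}\qquad(0\le j\le q-1,\ \alpha\in(1-j)\rho+\mathbb F_p\sigma),$$ with $0^0=1$, and let $$X=\sum_{i=0}^{p-1}(\rho+\sigma)^i x^{(i)},\qquad Y=-\sigma^{p-1}\bar x\bar y+\sum_{i=0}^{p-1}(2\rho+\sigma)^i x^{(i)}\bar y .$$ Then: 1. $X=e_{1,\rho+\sigma}$ and $Y=e_{2-q,2\rho+\sigma}$; the $e_{1-j,\alpha}$ form a basis of $H$, and $\{e_0,e_{1-j,\alpha}\}=\alpha e_{1-j,\alpha}$. 2. $X$ and $Y$ generate $H$. There is exactly one Lie algebra grading of $H$ over $\mathbb Z/(q-1)p\mathbb Z$ in which $X$ and $Y$ have degree $1$. Each $e_{r,r\rho+s\sigma}$ $(r=1-j,\ s\in\mathbb Z)$ is homogeneous in it, of the degree $k$ determined by $k\equiv r\pmod{q-1}$ and $k\equiv s\pmod p$. 3. Let $N$ be the loop algebra of $H$ for this grading, that is, the Lie subalgebra of $H\otimes\mathbb F[t]$ generated by $H_{\bar1}\otimes t$, with components $N_k=N\cap(H\otimes t^k)$. Then $N=\bigoplus_{k\ge1}N_k$ is an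 infinite-dimensional thin Lie algebra: it is graded, $\dim N_1=2$, $[u,N_1]=N_{i+1}$ for all $i\ge1$ and $0\ne u\in N_i$, and some $N_i$ with $i>1$ is a diamond, that is, has dimension $2$. Its second diamond (the first one after $N_1$) occurs in degree $q$, so that $N$ is a Nottingham Lie algebra, and $N_i$ $(i\ge1)$ is a diamond if and only if $i\equiv1\pmod{q-1}$. 4. Write $X,Y$ also for $X\otimes t$, $Y\otimes t$, and $[a,b,c]=[[a,b],c]$. These elements form a basis of $N_1$ satisfying $[N_2,Y]=0$ if $q>3$, and $[V,X,X]=0=[V,Y,Y]$, $[V,Y,X]=-2[V,X,Y]$ for $V\in N_{q-1}$. With respect to them, for every $t\ge2$ the $t$-th diamond, which is in degree $(t-1)(q-1)+1$, has the finite type $$\mu_t=-1+(t-2)\sigma/\rho ,$$ that is, the preceding component has dimension one, and $[V,Y,Y]=0=[V,X,X]$, $(1-\mu_t)[V,X,Y]=\mu_t[V,Y,X]$ for $V$ in it. In particular the types form an arithmetic progression, and $\mu_3=-1+\sigma/\rho$ does not lie in the prime field. -/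

import Mathlib

open scoped TensorProduct

noncomputable section

namespace AlbertZassenhaus

/-! ### The truncated divided power algebra in two indeterminates -/

/-- The vector space with basis the monomials `x^(i) y^(j)`, `0 ≤ i < r`, `0 ≤ j < s`.  For
`r = p ^ n₁` and `s = p ^ n₂` over a field of characteristic `p` this is the divided power algebra
`O(2; (n₁, n₂))`. -/
def DivPow (F : Type*) [Field F] (r s : ℕ) : Type _ := (Fin r × Fin s) →₀ F

namespace DivPow

variable {F : Type*} [Field F] {r s : ℕ}

instance : AddCommGroup (DivPow F r s) := inferInstanceAs (AddCommGroup ((Fin r × Fin s) →₀ F))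

instance : Module F (DivPow F r s) := inferInstanceAs (Module F ((Fin r × Fin s) →₀ F))

/-- The basis of monomials. -/
def basis (F : Type*) [Field F] (r s : ℕ) : Module.Basis (Fin r × Fin s) F (DivPow F r s) :=
  Module.Basis.ofRepr (LinearEquiv.refl F ((Fin r × Fin s) →₀ F))

/-- The monomial `x^(i) y^(j)`, read as zero outside the range `i < r`, `j < s`. -/
def mon (F : Type*) [Field F] (r s i j : ℕ) : DivPow F r s :=
  if h : i < r ∧ j < s then basis F r s (⟨i, h.1⟩, ⟨j, h.2⟩) else 0

/-- The product, given on monomials by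
`x^(i) y^(j) * x^(k) y^(l) = (i+k choose i) (j+l choose j) x^(i+k) y^(j+l)`. -/
def mulLin (F : Type*) [Field F] (r s : ℕ) :
    DivPow F r s →ₗ[F] DivPow F r s →ₗ[F] DivPow F r s :=
  (basis F r s).constr F fun a => (basis F r s).constr F fun b =>
    ((((a.1 + b.1 : ℕ).choose a.1) * ((a.2 + b.2 : ℕ).choose a.2) : ℕ) : F) •
      mon F r s (a.1 + b.1) (a.2 + b.2)

/-- The derivation `∂₁`, with `∂₁ (x^(i) y^(j)) = x^(i-1) y^(j)` (zero if `i = 0`). -/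
def d1 (F : Type*) [Field F] (r s : ℕ) : DivPow F r s →ₗ[F] DivPow F r s :=
  (basis F r s).constr F fun a => if (a.1 : ℕ) = 0 then 0 else mon F r s (a.1 - 1) a.2

/-- The derivation `∂₂`, with `∂₂ (x^(i) y^(j)) = x^(i) y^(j-1)` (zero if `j = 0`). -/
def d2 (F : Type*) [Field F] (r s : ℕ) : DivPow F r s →ₗ[F] DivPow F r s :=
  (basis F r s).constr F fun a => if (a.2 : ℕ) = 0 then 0 else mon F r s a.1 (a.2 - 1)

theorem basis_eq_mon (a : Fin r × Fin s) : basis F r s a = mon F r s a.1 a.2 := by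
  simp [mon]

theorem mon_eq_zero {i j : ℕ} (h : ¬ (i < r ∧ j < s)) : mon F r s i j = 0 := by
  simp [mon, h]

theorem mulLin_mon_mon (i j k l : ℕ) (h : i < r ∧ j < s) (h' : k < r ∧ l < s) :
    mulLin F r s (mon F r s i j) (mon F r s k l) =
      (((i + k).choose i * (j + l).choose j : ℕ) : F) • mon F r s (i + k) (j + l) := by
  have e1 := basis_eq_mon (F := F) (r := r) (s := s) (⟨i, h.1⟩, ⟨j, h.2⟩)
  have e2 := basis_eq_mon (F := F) (r := r) (s := s) (⟨k, h'.1⟩, ⟨l, h'.2⟩)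
  simp only at e1 e2
  rw [← e1, ← e2]
  simp [mulLin]

theorem mul_mon (i j k l : ℕ) :
    mulLin F r s (mon F r s i j) (mon F r s k l) =
      (((i + k).choose i * (j + l).choose j : ℕ) : F) • mon F r s (i + k) (j + l) := by
  by_cases h : i < r ∧ j < s
  · by_cases h' : k < r ∧ l < s
    · exact mulLin_mon_mon i j k l h h'
    · rw [mon_eq_zero h', mon_eq_zero (i := i + k) (j := j + l) (by omega)]; simp
  · rw [mon_eq_zero h, mon_eq_zero (i := i + k) (j := j + l) (by omega)]; simp

theorem mulLin_comm (f g : DivPow F r s) : mulLin F r s f g = mulLin F r s g f := by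
  suffices H : mulLin F r s = (mulLin F r s).flip by
    conv_lhs => rw [H]
    rfl
  refine (basis F r s).ext fun a => (basis F r s).ext fun b => ?_
  rw [LinearMap.flip_apply, basis_eq_mon, basis_eq_mon, mul_mon, mul_mon,
    add_comm (b.1 : ℕ), add_comm (b.2 : ℕ), Nat.choose_symm_add, Nat.choose_symm_add]

theorem choose_assoc (i k u : ℕ) :
    (i + k).choose i * (i + k + u).choose (i + k) =
      (k + u).choose k * (i + (k + u)).choose i := by
  have := Nat.choose_mul (n := i + k + u) (k := i + k) (s := i) (by omega)
  rw [show i + k + u - i = k + u by omega, show i + k - i = k by omega] at this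
  rw [← add_assoc]
  linarith

theorem induct {P : DivPow F r s → Prop} (f : DivPow F r s)
    (hmon : ∀ i j, P (mon F r s i j)) (hadd : ∀ f g, P f → P g → P (f + g))
    (hsmul : ∀ (c : F) f, P f → P (c • f)) : P f := by
  have hf : f ∈ Submodule.span F (Set.range (basis F r s)) := by
    rw [(basis F r s).span_eq]; trivial
  induction hf using Submodule.span_induction with
  | mem x hx =>
    obtain ⟨a, rfl⟩ := hx
    rw [basis_eq_mon]
    exact hmon _ _
  | zero => simpa using hsmul 0 _ (hmon 0 0)
  | add x y _ _ hx hy => exact hadd _ _ hx hy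
  | smul c x _ hx => exact hsmul _ _ hx

theorem mulLin_assoc (f g h : DivPow F r s) :
    mulLin F r s (mulLin F r s f g) h = mulLin F r s f (mulLin F r s g h) := by
  induction f using induct with
  | hadd f f' hf hf' => simp [hf, hf']
  | hsmul c f hf => simp [hf]
  | hmon i j =>
    induction g using induct with
    | hadd f f' hf hf' => simp [hf, hf']
    | hsmul c f hf => simp [hf]
    | hmon k l =>
      induction h using induct with
      | hadd f f' hf hf' => simp [hf, hf']
      | hsmul c f hf => simp [hf]
      | hmon u v =>
        simp only [mul_mon, map_smul, LinearMap.smul_apply, smul_smul]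
        rw [← add_assoc i, ← add_assoc j, ← Nat.cast_mul, ← Nat.cast_mul]
        congr 2
        have h1 := choose_assoc i k u
        have h2 := choose_assoc j l v
        rw [← add_assoc] at h1 h2
        calc _ = ((i + k).choose i * (i + k + u).choose (i + k)) *
                ((j + l).choose j * (j + l + v).choose (j + l)) := by ring
          _ = _ := by rw [h1, h2]; ring

theorem one_mulLin (f : DivPow F r s) : mulLin F r s (mon F r s 0 0) f = f := by
  induction f using induct with
  | hadd f f' hf hf' => simp [hf, hf']
  | hsmul c f hf => simp [hf]
  | hmon i j => simp [mul_mon]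

instance : CommRing (DivPow F r s) where
  __ := (inferInstance : AddCommGroup (DivPow F r s))
  mul f g := mulLin F r s f g
  one := mon F r s 0 0
  mul_assoc := mulLin_assoc
  mul_comm := mulLin_comm
  one_mul := one_mulLin
  mul_one f := (mulLin_comm _ _).trans (one_mulLin f)
  left_distrib f g h := map_add (mulLin F r s f) g h
  right_distrib f g h := LinearMap.map_add₂ (mulLin F r s) f g h
  zero_mul f := LinearMap.map_zero₂ (mulLin F r s) f
  mul_zero f := map_zero (mulLin F r s f)

theorem mul_def (f g : DivPow F r s) : f * g = mulLin F r s f g := rfl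

instance : Algebra F (DivPow F r s) :=
  Algebra.ofModule
    (fun c f g => LinearMap.map_smul₂ (mulLin F r s) c f g)
    (fun c f g => map_smul (mulLin F r s f) c g)

theorem mon_mul_mon (i j k l : ℕ) :
    mon F r s i j * mon F r s k l =
      (((i + k).choose i * (j + l).choose j : ℕ) : F) • mon F r s (i + k) (j + l) :=
  mul_mon i j k l

theorem d1_mon (i j : ℕ) (h : i < r) :
    d1 F r s (mon F r s i j) = if i = 0 then 0 else mon F r s (i - 1) j := by
  by_cases hj : j < s
  · have e1 := basis_eq_mon (F := F) (r := r) (s := s) (⟨i, h⟩, ⟨j, hj⟩)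
    simp only at e1
    rw [← e1]
    exact (basis F r s).constr_basis F _ _
  · rw [mon_eq_zero (by omega), mon_eq_zero (i := i - 1) (by omega)]; simp

theorem d2_mon (i j : ℕ) (h : j < s) :
    d2 F r s (mon F r s i j) = if j = 0 then 0 else mon F r s i (j - 1) := by
  by_cases hi : i < r
  · have e1 := basis_eq_mon (F := F) (r := r) (s := s) (⟨i, hi⟩, ⟨j, h⟩)
    simp only at e1
    rw [← e1]
    exact (basis F r s).constr_basis F _ _
  · rw [mon_eq_zero (by omega), mon_eq_zero (j := j - 1) (by omega)]; simp

theorem d1_d2 (f : DivPow F r s) : d1 F r s (d2 F r s f) = d2 F r s (d1 F r s f) := by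
  induction f using induct with
  | hadd f f' hf hf' => simp [hf, hf']
  | hsmul c f hf => simp [hf]
  | hmon i j =>
    by_cases h : i < r ∧ j < s
    · rw [d2_mon _ _ h.2, d1_mon _ _ h.1]
      rcases i with _ | i <;> rcases j with _ | j
      · simp
      · simp [d1_mon _ _ h.1]
      · simp [d2_mon _ _ h.2]
      · have h1 : i < r := by omega
        have h2 : j < s := by omega
        simp [d1_mon _ _ h.1, d2_mon _ _ h.2]
    · simp [mon_eq_zero h]

theorem choose_cast_eq_zero {p n : ℕ} [Fact p.Prime] [CharP F p] {i k : ℕ}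
    (hi : i < p ^ n) (hk : k < p ^ n) (h : i + k = p ^ n) : ((i + k).choose i : F) = 0 := by
  rw [h, CharP.cast_eq_zero_iff F p]
  exact (Fact.out : p.Prime).dvd_choose_pow (by omega) (by omega)

theorem d1_mul {p n : ℕ} [Fact p.Prime] [CharP F p] (f g : DivPow F (p ^ n) s) :
    d1 F (p ^ n) s (f * g) = d1 F (p ^ n) s f * g + f * d1 F (p ^ n) s g := by
  induction f using induct with
  | hadd f f' hf hf' => simp only [add_mul, map_add, hf, hf']; ring
  | hsmul c f hf => simp only [Algebra.smul_mul_assoc, map_smul, hf, smul_add]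
  | hmon i j =>
    induction g using induct with
    | hadd f f' hf hf' => simp only [mul_add, map_add, hf, hf']; ring
    | hsmul c f hf => simp only [Algebra.mul_smul_comm, map_smul, hf, smul_add]
    | hmon k l =>
      by_cases hi : i < p ^ n
      swap
      · simp [mon_eq_zero (F := F) (r := p ^ n) (s := s) (i := i) (j := j) (by omega)]
      by_cases hk : k < p ^ n
      swap
      · simp [mon_eq_zero (F := F) (r := p ^ n) (s := s) (i := k) (j := l) (by omega)]
      rw [d1_mon _ _ hi, d1_mon _ _ hk, mon_mul_mon, map_smul]
      rcases i with _ | i <;> rcases k with _ | k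
      · simp [d1_mon _ _ hi]
      · simp [d1_mon _ _ hk, mon_mul_mon]
      · simp [d1_mon _ _ hi, mon_mul_mon]
      · simp only [Nat.add_eq_zero_iff, one_ne_zero, and_false, if_false, Nat.add_sub_cancel,
          mon_mul_mon]
        rw [show i + (k + 1) = i + k + 1 by ring, show i + 1 + k = i + k + 1 by ring, ← add_smul,
          show i + 1 + (k + 1) = i + k + 1 + 1 by ring]
        have hc : (i + k + 1 + 1).choose (i + 1) = (i + k + 1).choose i +
          (i + k + 1).choose (i + 1) := Nat.choose_succ_succ _ _
        rcases lt_trichotomy (i + k + 1 + 1) (p ^ n) with h | h | h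
        · rw [d1_mon _ _ h, hc]
          simp [add_mul]
        · have h0 := choose_cast_eq_zero (F := F) hi hk (by omega)
          rw [show i + 1 + (k + 1) = i + k + 1 + 1 by ring] at h0
          rw [← Nat.cast_add, ← add_mul, ← hc]
          simp [h0]
        · rw [mon_eq_zero (i := i + k + 1 + 1) (by omega), mon_eq_zero (i := i + k + 1) (by omega)]
          simp

theorem d2_mul {p n : ℕ} [Fact p.Prime] [CharP F p] (f g : DivPow F r (p ^ n)) :
    d2 F r (p ^ n) (f * g) = d2 F r (p ^ n) f * g + f * d2 F r (p ^ n) g := by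
  induction f using induct with
  | hadd f f' hf hf' => simp only [add_mul, map_add, hf, hf']; ring
  | hsmul c f hf => simp only [Algebra.smul_mul_assoc, map_smul, hf, smul_add]
  | hmon i j =>
    induction g using induct with
    | hadd f f' hf hf' => simp only [mul_add, map_add, hf, hf']; ring
    | hsmul c f hf => simp only [Algebra.mul_smul_comm, map_smul, hf, smul_add]
    | hmon k l =>
      by_cases hj : j < p ^ n
      swap
      · simp [mon_eq_zero (F := F) (r := r) (s := p ^ n) (i := i) (j := j) (by omega)]
      by_cases hl : l < p ^ n
      swap
      · simp [mon_eq_zero (F := F) (r := r) (s := p ^ n) (i := k) (j := l) (by omega)]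
      rw [d2_mon _ _ hj, d2_mon _ _ hl, mon_mul_mon, map_smul]
      rcases j with _ | j <;> rcases l with _ | l
      · simp [d2_mon _ _ hj]
      · simp [d2_mon _ _ hl, mon_mul_mon]
      · simp [d2_mon _ _ hj, mon_mul_mon]
      · simp only [Nat.add_eq_zero_iff, one_ne_zero, and_false, if_false, Nat.add_sub_cancel,
          mon_mul_mon]
        rw [show j + (l + 1) = j + l + 1 by ring, show j + 1 + l = j + l + 1 by ring, ← add_smul,
          show j + 1 + (l + 1) = j + l + 1 + 1 by ring]
        have hc : (j + l + 1 + 1).choose (j + 1) = (j + l + 1).choose j +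
          (j + l + 1).choose (j + 1) := Nat.choose_succ_succ _ _
        rcases lt_trichotomy (j + l + 1 + 1) (p ^ n) with h | h | h
        · rw [d2_mon _ _ h, hc]
          simp [mul_add]
        · have h0 := choose_cast_eq_zero (F := F) hj hl (by omega)
          rw [show j + 1 + (l + 1) = j + l + 1 + 1 by ring] at h0
          rw [← Nat.cast_add, ← mul_add, ← hc]
          simp [h0]
        · rw [mon_eq_zero (j := j + l + 1 + 1) (by omega), mon_eq_zero (j := j + l + 1) (by omega)]
          simp

end DivPow

/-! ### The Hamiltonian algebra `H(2; (n₁, n₂); Φ(1))` -/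

/-- The Lie algebra `H(2; (n₁, n₂); Φ(1))` over the field `F` of characteristic `p`, realized on
the divided power algebra `O(2; (n₁, n₂))`.  Its element `f` stands for the special derivation
`∂₂(f) ∂₁ - (∂₁(f) + x̄ f) ∂₂`, where `x̄ = x^(p^n₁ - 1)`. -/
def Ham (F : Type*) [Field F] (p n₁ n₂ : ℕ) : Type _ := DivPow F (p ^ n₁) (p ^ n₂)

namespace Ham

variable {F : Type*} [Field F] {p n₁ n₂ : ℕ}

instance : AddCommGroup (Ham F p n₁ n₂) :=
  inferInstanceAs (AddCommGroup (DivPow F (p ^ n₁) (p ^ n₂)))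

instance : Module F (Ham F p n₁ n₂) :=
  inferInstanceAs (Module F (DivPow F (p ^ n₁) (p ^ n₂)))

/-- The bracket `{f, g} = ∂₂(f) ∂₁(g) - ∂₁(f) ∂₂(g) + x̄ (∂₂(f) g - f ∂₂(g))`. -/
def poisson (f g : DivPow F (p ^ n₁) (p ^ n₂)) : DivPow F (p ^ n₁) (p ^ n₂) :=
  DivPow.d2 F _ _ f * DivPow.d1 F _ _ g - DivPow.d1 F _ _ f * DivPow.d2 F _ _ g +
    DivPow.mon F _ _ (p ^ n₁ - 1) 0 * (DivPow.d2 F _ _ f * g - f * DivPow.d2 F _ _ g)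

theorem d2_xbar [Fact p.Prime] :
    DivPow.d2 F (p ^ n₁) (p ^ n₂) (DivPow.mon F _ _ (p ^ n₁ - 1) 0) = 0 := by
  rw [DivPow.d2_mon _ _ (pow_pos (Fact.out : p.Prime).pos _)]
  simp

theorem poisson_add_left (f g h : DivPow F (p ^ n₁) (p ^ n₂)) :
    poisson (f + g) h = poisson f h + poisson g h := by
  simp only [poisson, map_add]
  ring

theorem poisson_add_right (f g h : DivPow F (p ^ n₁) (p ^ n₂)) :
    poisson f (g + h) = poisson f g + poisson f h := by
  simp only [poisson, map_add]
  ring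

theorem poisson_self (f : DivPow F (p ^ n₁) (p ^ n₂)) : poisson f f = 0 := by
  simp only [poisson]
  ring

theorem poisson_smul_right (c : F) (f g : DivPow F (p ^ n₁) (p ^ n₂)) :
    poisson f (c • g) = c • poisson f g := by
  simp only [poisson, map_smul, Algebra.mul_smul_comm, smul_add, smul_sub, mul_sub]

theorem poisson_jacobi [Fact p.Prime] [CharP F p] (f g h : DivPow F (p ^ n₁) (p ^ n₂)) :
    poisson f (poisson g h) = poisson (poisson f g) h + poisson g (poisson f h) := by
  simp only [poisson, map_add, map_sub, DivPow.d1_mul, DivPow.d2_mul, d2_xbar, DivPow.d1_d2]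
  ring

instance [Fact p.Prime] [CharP F p] : LieRing (Ham F p n₁ n₂) where
  bracket f g := poisson f g
  add_lie := poisson_add_left
  lie_add := poisson_add_right
  lie_self := poisson_self
  leibniz_lie := poisson_jacobi

instance [Fact p.Prime] [CharP F p] : LieAlgebra F (Ham F p n₁ n₂) where
  lie_smul := poisson_smul_right

/-- The monomial `x^(i) y^(j)` as an element of `H(2; (n₁, n₂); Φ(1))`. -/
def mon (F : Type*) [Field F] (p n₁ n₂ i j : ℕ) : Ham F p n₁ n₂ :=
  DivPow.mon F (p ^ n₁) (p ^ n₂) i j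

/-- The element `y + π x̄ y`. -/
def e₀ (p n₁ n₂ : ℕ) (π : F) : Ham F p n₁ n₂ :=
  mon F p n₁ n₂ 0 1 + π • mon F p n₁ n₂ (p ^ n₁ - 1) 1

/-- The element `e_{1-j, α} = π j x̄ y^(j) + ∑ i < p^n₁, α^i x^(i) y^(j)`, with `0 ^ 0 = 1`. -/
def eigvec (p n₁ n₂ : ℕ) (π : F) (j : ℕ) (α : F) : Ham F p n₁ n₂ :=
  (π * j) • mon F p n₁ n₂ (p ^ n₁ - 1) j +
    ∑ i ∈ Finset.range (p ^ n₁), α ^ i • mon F p n₁ n₂ i j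

/-- `X = ∑ i < p, (ρ + σ)^i x^(i)`, in `H(2; (1, n); Φ(1))`. -/
def genX (p n : ℕ) (σ ρ : F) : Ham F p 1 n :=
  ∑ i ∈ Finset.range p, (ρ + σ) ^ i • mon F p 1 n i 0

/-- `Y = -σ^(p-1) x̄ ȳ + ∑ i < p, (2 ρ + σ)^i x^(i) ȳ`, in `H(2; (1, n); Φ(1))`, where
`x̄ = x^(p-1)` and `ȳ = y^(p^n-1)`. -/
def genY (p n : ℕ) (σ ρ : F) : Ham F p 1 n :=
  -(σ ^ (p - 1)) • mon F p 1 n (p - 1) (p ^ n - 1) +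
    ∑ i ∈ Finset.range p, (2 * ρ + σ) ^ i • mon F p 1 n i (p ^ n - 1)

end Ham

/-! ### Gradings, loop algebras, thin Lie algebras -/

section Graded

variable {F L : Type*} [Field F] [LieRing L] [LieAlgebra F L]

/-- The subspaces `𝓛 i` form a grading of the Lie algebra `L` over the additive monoid `ι`. -/
structure IsLieGrading {ι : Type*} [DecidableEq ι] [AddMonoid ι] (𝓛 : ι → Submodule F L) :
    Prop where
  isInternal : DirectSum.IsInternal 𝓛
  bracket_mem : ∀ i j : ι, ∀ x ∈ 𝓛 i, ∀ y ∈ 𝓛 j, ⁅x, y⁆ ∈ 𝓛 (i + j)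

/-- The loop algebra of `L` with respect to the subspace `U`: the Lie subalgebra of `F[t] ⊗ L`
generated by `t ⊗ U`. -/
def loopAlgebra (U : Submodule F L) : LieSubalgebra F (Polynomial F ⊗[F] L) :=
  LieSubalgebra.lieSpan F (Polynomial F ⊗[F] L)
    {z | ∃ u ∈ U, z = (Polynomial.X : Polynomial F) ⊗ₜ[F] u}

/-- The element `t ⊗ u` of the loop algebra, for `u ∈ U`. -/
def loopGen (U : Submodule F L) (u : L) (hu : u ∈ U) : loopAlgebra U :=
  ⟨(Polynomial.X : Polynomial F) ⊗ₜ[F] u, LieSubalgebra.subset_lieSpan ⟨u, hu, rfl⟩⟩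

/-- The component of degree `k` of the loop algebra: its elements that lie in `t^k ⊗ L`. -/
def loopComponent (U : Submodule F L) (k : ℕ) : Submodule F (loopAlgebra U) :=
  Submodule.comap (loopAlgebra U).toSubmodule.subtype
    (LinearMap.range (TensorProduct.mk F (Polynomial F) L (Polynomial.X ^ k)))

/-- An infinite-dimensional thin Lie algebra `L = ⨁_{i ≥ 1} 𝓛 i` (with at least two diamonds,
that is, not of maximal class). -/
structure IsThin (𝓛 : ℕ → Submodule F L) : Prop where
  isLieGrading : IsLieGrading 𝓛
  zero : 𝓛 0 = ⊥
  finrank_one : Module.finrank F (𝓛 1) = 2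
  covering : ∀ i, 1 ≤ i → ∀ u ∈ 𝓛 i, u ≠ 0 → ∀ w ∈ 𝓛 (i + 1), ∃ v ∈ 𝓛 1, ⁅u, v⁆ = w
  infinite : ¬ FiniteDimensional F L
  exists_diamond : ∃ i, 1 < i ∧ Module.finrank F (𝓛 i) = 2

/-- The second diamond (the first two-dimensional component after `𝓛 1`) occurs in degree `q`. -/
def SecondDiamondIn (𝓛 : ℕ → Submodule F L) (q : ℕ) : Prop :=
  1 < q ∧ Module.finrank F (𝓛 q) = 2 ∧ ∀ i, 1 < i → i < q → Module.finrank F (𝓛 i) ≠ 2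

/-- The distinguished generators `X`, `Y` of a thin Lie algebra with second diamond in degree `q`,
to which diamond types refer: a basis of `𝓛 1` such that `[𝓛 2, Y] = 0` (only if `q > 3`) and
`[V, X, X] = 0 = [V, Y, Y]`, `[V, Y, X] = -2 [V, X, Y]` for `V` in `𝓛 (q - 1)`. -/
structure IsDistinguishedPair (𝓛 : ℕ → Submodule F L) (q : ℕ) (X Y : L) : Prop where
  X_mem : X ∈ 𝓛 1
  Y_mem : Y ∈ 𝓛 1
  linearIndependent : LinearIndependent F ![X, Y]
  centralizer : 3 < q → ∀ w ∈ 𝓛 2, ⁅w, Y⁆ = 0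
  rel : ∀ V ∈ 𝓛 (q - 1), ⁅⁅V, X⁆, X⁆ = 0 ∧ ⁅⁅V, Y⁆, Y⁆ = 0 ∧
    ⁅⁅V, Y⁆, X⁆ = (-2 : F) • ⁅⁅V, X⁆, Y⁆

/-- The component in degree `i > 1` is a (genuine) diamond of finite type `μ`, with respect to the
distinguished generators `X`, `Y`. -/
def IsDiamondOfType (𝓛 : ℕ → Submodule F L) (X Y : L) (i : ℕ) (μ : F) : Prop :=
  1 < i ∧ Module.finrank F (𝓛 i) = 2 ∧ Module.finrank F (𝓛 (i - 1)) = 1 ∧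
    ∀ V ∈ 𝓛 (i - 1), ⁅⁅V, Y⁆, Y⁆ = 0 ∧ ⁅⁅V, X⁆, X⁆ = 0 ∧
      (1 - μ) • ⁅⁅V, X⁆, Y⁆ = μ • ⁅⁅V, Y⁆, X⁆

end Graded

end AlbertZassenhaus

end

/-!
Put `q = p^n` and `π = σ^(p-1)`.  The exponentials `E(α) = ∑ i < p, α^i x^(i)` satisfy
`E(α) E(β) = E(α + β)` and `∂₁ E(α) = α E(α) - α^p x̄` (`DivPow.expX_mul_expX`,
`DivPow.d1_expX`).
The scalars `α = (1 - j) ρ + s σ` are roots of `α^p = π α + (1 - j)` (`root_pow`), and for such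
scalars the vectors `e_{1-j, α} = (E(α) + π j x̄) y^(j)` are closed under the bracket, up to scalars:
for `j + k = l + 1`,
`{e_{1-j, α}, e_{1-k, β}} = ((l choose k) β - (l choose j) α) e_{1-l, α+β}`
(`Ham.lie_eigvec_eigvec`).  They are linearly independent by a Vandermonde argument, hence form a
basis, and giving `e_{1-j, (1-j)ρ+sσ}` the degree that is `1 - j` modulo `q - 1` and `s` modulo `p`
defines a grading over `ℤ/(q-1)pℤ`.  Its components have dimension `2` in the degrees congruent to
`1` modulo `q - 1`, where both `j = 0` and `j = q - 1` contribute, and dimension `1` elsewhere.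

The component of degree `1` is spanned by `X` and `Y`, and `ad X`, `ad Y` act by explicit scalars:
`ad X` lowers `j` by one, with the factor `ρ + σ`, and `ad Y` only acts on `j = 1` and `j = 0`, with
the factors `2ρ + (s+1)σ` and `-(ρ + sσ)`.  None of these vanishes, because a scalar
`(1 - j) ρ + s σ` that vanishes forces `1 - j = 0` by `root_pow`.  This gives the covering property
in the cyclic grading (`evGrading_cyclicCovering`).

The remaining structural claims follow from the covering property alone.  Every component is reached
from degree `1` (`CyclicCovering.le_of_lie_mem`), so `X` and `Y` generate, the grading is unique, and
the loop algebra is `⨁_{k ≥ 1} t^k ⊗ H_k`; its components are thus copies of those of the grading,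
and it is thin (`loopComponent_isThin`).  The diamond types are read off the scalars above
(`lie_lie_of_mem_evGrading`).  Finally `σ / ρ` is not in the prime field, as it is not fixed by the
Frobenius map.
-/

noncomputable section

namespace AlbertZassenhaus

/-! ### Exponentials in the divided power algebra -/

namespace DivPow

variable {F : Type*} [Field F] {r s : ℕ}

/-- The truncated exponential `∑ i < r, α^i x^(i)`, with `0 ^ 0 = 1`. -/
def expX (F : Type*) [Field F] (r s : ℕ) (α : F) : DivPow F r s :=
  ∑ i ∈ Finset.range r, α ^ i • mon F r s i 0

theorem mon_mul_mon_zero (i j : ℕ) : mon F r s i 0 * mon F r s 0 j = mon F r s i j := by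
  simp [mon_mul_mon]

/-- Products of divided powers encode the binomial theorem, so `expX` is multiplicative. -/
theorem expX_mul_expX (α β : F) :
    expX F r s α * expX F r s β = expX F r s (α + β) := by
  have h : ∀ m, (α + β) ^ m • mon F r s m 0 = ∑ k ∈ Finset.range (m + 1),
      (α ^ k * β ^ (m - k) * ((k + (m - k)).choose k : F)) • mon F r s (k + (m - k)) 0 := by
    intro m
    rw [add_pow, Finset.sum_smul]
    refine Finset.sum_congr rfl fun k hk => ?_
    rw [Nat.add_sub_cancel' (Nat.lt_succ_iff.mp (Finset.mem_range.mp hk))]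
  unfold expX
  simp only [h]
  rw [Finset.sum_range_diag_flip r
    (fun i k => (α ^ i * β ^ k * ((i + k).choose i : F)) • mon F r s (i + k) 0),
    Finset.sum_mul]
  refine Finset.sum_congr rfl fun i _ => ?_
  rw [Finset.mul_sum]
  symm
  refine Finset.sum_subset_zero_on_sdiff (Finset.range_mono (by omega)) ?_ ?_
  · intro k hk
    simp only [Finset.mem_sdiff, Finset.mem_range] at hk
    rw [smul_mul_smul_comm, mon_mul_mon, mon_eq_zero (by omega)]
    simp
  · intro k _
    rw [smul_mul_smul_comm, mon_mul_mon, smul_smul]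
    simp

theorem xbar_mul_expX (hr : 1 ≤ r) (α : F) :
    mon F r s (r - 1) 0 * expX F r s α = mon F r s (r - 1) 0 := by
  unfold expX
  rw [Finset.mul_sum, Finset.sum_eq_single 0]
  · simp [mon_mul_mon]
  · intro i _ hi
    rw [mul_smul_comm, mon_mul_mon, mon_eq_zero (by omega)]
    simp
  · intro h
    simp at h
    omega

theorem mon_sub_two_mul_expX (hr : 2 ≤ r) (h0 : (r : F) = 0) (α : F) :
    mon F r s (r - 2) 0 * expX F r s α = mon F r s (r - 2) 0 - α • mon F r s (r - 1) 0 := by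
  unfold expX
  rw [Finset.mul_sum, ← Finset.sum_subset (s₁ := {0, 1})]
  · have h2 : r - 2 + 1 = r - 1 := by omega
    have h3 : ((r - 1 : ℕ) : F) = -1 := by rw [Nat.cast_sub (by omega), h0]; simp
    rw [Finset.sum_pair (by simp)]
    simp only [pow_zero, one_smul, pow_one, mul_smul_comm, mon_mul_mon, h2, add_zero,
      Nat.choose_self]
    rw [show (r - 1).choose (r - 2) = r - 1 by
      rw [← h2, Nat.choose_succ_self_right]]
    simp [h3, sub_eq_add_neg]
  · intro i
    simp only [Finset.mem_insert, Finset.mem_singleton, Finset.mem_range]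
    omega
  · intro i _ hi
    simp only [Finset.mem_insert, Finset.mem_singleton] at hi
    rw [mul_smul_comm, mon_mul_mon, mon_eq_zero (by omega)]
    simp

theorem d1_expX (hr : 1 ≤ r) (α : F) :
    d1 F r s (expX F r s α) = α • expX F r s α - α ^ r • mon F r s (r - 1) 0 := by
  obtain ⟨r, rfl⟩ : ∃ k, r = k + 1 := ⟨r - 1, by omega⟩
  unfold expX
  rw [map_sum, Finset.sum_range_succ', Finset.sum_range_succ, smul_add, Finset.smul_sum]
  simp only [map_smul, Nat.add_sub_cancel, smul_smul, ← pow_succ']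
  rw [d1_mon 0 0 (by omega), add_sub_cancel_right]
  simp only [if_true, smul_zero, add_zero]
  refine Finset.sum_congr rfl fun i hi => ?_
  rw [d1_mon _ _ (by have := Finset.mem_range.mp hi; omega)]
  simp

theorem d2_mon_zero (hs : 1 ≤ s) (i : ℕ) : d2 F r s (mon F r s i 0) = 0 := by
  rw [d2_mon _ _ hs]; simp

theorem d2_expX (hs : 1 ≤ s) (α : F) : d2 F r s (expX F r s α) = 0 := by
  unfold expX
  simp [d2_mon_zero hs]

theorem d1_mon_zero (hr : 1 ≤ r) (j : ℕ) : d1 F r s (mon F r s 0 j) = 0 := by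
  rw [d1_mon _ _ hr]; simp

theorem d2_mon_mul_mon {j k l : ℕ} (hj : j < s) (h : j + k = l + 1) :
    d2 F r s (mon F r s 0 j) * mon F r s 0 k = (l.choose k : F) • mon F r s 0 l := by
  rw [d2_mon _ _ hj]
  rcases j with _ | j
  · have : k = l + 1 := by omega
    simp [this]
  · obtain rfl : l = j + k := by omega
    simp [mon_mul_mon, Nat.choose_symm_add]

end DivPow

/-! ### The bracket of eigenvectors -/

theorem choose_mul_eq_choose_mul {j k l : ℕ} (h : j + k = l + 1) :
    l.choose k * k = l.choose j * j := by
  rcases j with _ | j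
  · have : k = l + 1 := by omega
    simp [this]
  · rw [Nat.choose_succ_right_eq, show l - j = k by omega]
    obtain rfl : l = j + k := by omega
    rw [Nat.choose_symm_add]

namespace Ham

open DivPow

variable {F : Type*} [Field F] {p n₁ n₂ : ℕ}

/-- The product form of `e_{1-j, α}` in the divided power algebra: an exponential in `x`, corrected
by a multiple of `x̄`, times `y^(j)`. -/
def eigvecProd (r s : ℕ) (π : F) (j : ℕ) (α : F) : DivPow F r s :=
  (expX F r s α + (π * j) • DivPow.mon F r s (r - 1) 0) * DivPow.mon F r s 0 j

theorem eigvecProd_eq (r s : ℕ) (π : F) (j : ℕ) (α : F) :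
    eigvecProd r s π j α = (π * j) • DivPow.mon F r s (r - 1) j +
      ∑ i ∈ Finset.range r, α ^ i • DivPow.mon F r s i j := by
  rw [eigvecProd, add_mul, smul_mul_assoc, mon_mul_mon_zero, expX, Finset.sum_mul, add_comm]
  simp only [smul_mul_assoc, mon_mul_mon_zero]

theorem eigvecProd_eq_eigvec (π : F) (j : ℕ) (α : F) :
    eigvecProd (p ^ n₁) (p ^ n₂) π j α = eigvec p n₁ n₂ π j α :=
  eigvecProd_eq _ _ π j α

theorem eigvec_eq_zero (π : F) {j : ℕ} (hj : p ^ n₂ ≤ j) (α : F) :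
    eigvec p n₁ n₂ π j α = 0 := by
  have h : eigvecProd (p ^ n₁) (p ^ n₂) π j α = 0 := by
    rw [eigvecProd, DivPow.mon_eq_zero (i := 0) (by omega), mul_zero]
  exact (eigvecProd_eq_eigvec π j α).symm.trans h

theorem e₀_eq_eigvec [hp : Fact p.Prime] (π : F) : e₀ p n₁ n₂ π = eigvec p n₁ n₂ π 1 0 := by
  have h : 0 < p ^ n₁ := pow_pos hp.out.pos _
  unfold e₀ eigvec
  rw [Finset.sum_eq_single 0, add_comm]
  · simp
  · intro i _ hi
    simp [hi]
  · intro h0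
    exact absurd (Finset.mem_range.mpr h) h0

variable [Fact p.Prime] [CharP F p]

/-- The bracket of two vectors `e_{1-j, α}`.  The terms in `x^(p^n₁-2)` cancel by
`choose_mul_eq_choose_mul`; the conditions on `α` and `β` turn `α^(p^n₁)`, `β^(p^n₁)`, which come
from `∂₁`, into linear terms, and these leave the right multiple of `x̄`. -/
theorem poisson_eigvecProd (hn₁ : 3 ≤ p ^ n₁) (π : F) {j k l : ℕ} (h : j + k = l + 1)
    (hj : j < p ^ n₂) (hk : k < p ^ n₂) {α β : F} (hα : α ^ p ^ n₁ = π * α + (1 - j))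
    (hβ : β ^ p ^ n₁ = π * β + (1 - k)) :
    poisson (eigvecProd (p ^ n₁) (p ^ n₂) π j α) (eigvecProd (p ^ n₁) (p ^ n₂) π k β) =
      ((l.choose k : F) * β - (l.choose j : F) * α) •
        eigvecProd (p ^ n₁) (p ^ n₂) π l (α + β) := by
  have hr0 : ((p ^ n₁ : ℕ) : F) = 0 := by
    have : n₁ ≠ 0 := by rintro rfl; simp at hn₁
    simp [this]
  have hs : 1 ≤ p ^ n₂ := by omega
  rw [eigvecProd, eigvecProd, eigvecProd, poisson]
  have hd : d1 F (p ^ n₁) (p ^ n₂) (DivPow.mon F _ _ (p ^ n₁ - 1) 0) =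
      DivPow.mon F _ _ (p ^ n₁ - 2) 0 := by
    rw [d1_mon _ _ (by omega), if_neg (by omega)]; rfl
  simp only [d1_mul, d2_mul, map_add, map_smul, d1_expX (show 1 ≤ p ^ n₁ by omega),
    d2_expX hs, d2_mon_zero hs, d1_mon_zero (show 1 ≤ p ^ n₁ by omega), hd, hα, hβ]
  have e1 := expX_mul_expX (r := p ^ n₁) (s := p ^ n₂) α β
  have e2 := xbar_mul_expX (r := p ^ n₁) (s := p ^ n₂) (by omega) α
  have e3 := xbar_mul_expX (r := p ^ n₁) (s := p ^ n₂) (by omega) β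
  have e4 := mon_sub_two_mul_expX (s := p ^ n₂) (by omega) hr0 α
  have e5 := mon_sub_two_mul_expX (s := p ^ n₂) (by omega) hr0 β
  have e6 : DivPow.mon F (p ^ n₁) (p ^ n₂) (p ^ n₁ - 1) 0 * DivPow.mon F _ _ (p ^ n₁ - 1) 0 = 0 := by
    rw [mon_mul_mon, DivPow.mon_eq_zero (by omega), smul_zero]
  have e7 : DivPow.mon F (p ^ n₁) (p ^ n₂) (p ^ n₁ - 1) 0 * DivPow.mon F _ _ (p ^ n₁ - 2) 0 = 0 := by
    rw [mon_mul_mon, DivPow.mon_eq_zero (by omega), smul_zero]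
  have e8 := d2_mon_mul_mon (F := F) (r := p ^ n₁) hj h
  have e9 := d2_mon_mul_mon (F := F) (r := p ^ n₁) hk (l := l) (k := j) (by omega)
  have ec : (algebraMap F (DivPow F (p ^ n₁) (p ^ n₂))) ((l.choose k : F) * k) =
      algebraMap F _ ((l.choose j : F) * j) := by
    rw [← Nat.cast_mul, ← Nat.cast_mul, choose_mul_eq_choose_mul h]
  have el : (algebraMap F (DivPow F (p ^ n₁) (p ^ n₂))) ((j : F) + k) =
      algebraMap F _ ((l : F) + 1) := by
    rw [← Nat.cast_add, h, Nat.cast_succ]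
  simp only [Algebra.smul_def, map_add, map_sub, map_mul, map_one] at *
  generalize expX F (p ^ n₁) (p ^ n₂) α = A at *
  generalize expX F (p ^ n₁) (p ^ n₂) β = B at *
  generalize expX F (p ^ n₁) (p ^ n₂) (α + β) = E at *
  generalize DivPow.mon F (p ^ n₁) (p ^ n₂) (p ^ n₁ - 1) 0 = x at *
  generalize DivPow.mon F (p ^ n₁) (p ^ n₂) (p ^ n₁ - 2) 0 = w at *
  generalize d2 F (p ^ n₁) (p ^ n₂) (DivPow.mon F _ _ 0 j) = yj' at *
  generalize d2 F (p ^ n₁) (p ^ n₂) (DivPow.mon F _ _ 0 k) = yk' at *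
  generalize DivPow.mon F (p ^ n₁) (p ^ n₂) 0 j = yj at *
  generalize DivPow.mon F (p ^ n₁) (p ^ n₂) 0 k = yk at *
  generalize DivPow.mon F (p ^ n₁) (p ^ n₂) 0 l = yl at *
  generalize algebraMap F (DivPow F (p ^ n₁) (p ^ n₂)) (l.choose k : F) = c at *
  generalize algebraMap F (DivPow F (p ^ n₁) (p ^ n₂)) (l.choose j : F) = d at *
  generalize algebraMap F (DivPow F (p ^ n₁) (p ^ n₂)) (j : F) = J at *
  generalize algebraMap F (DivPow F (p ^ n₁) (p ^ n₂)) (k : F) = K at *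
  generalize algebraMap F (DivPow F (p ^ n₁) (p ^ n₂)) (l : F) = M at *
  generalize algebraMap F (DivPow F (p ^ n₁) (p ^ n₂)) α = a at *
  generalize algebraMap F (DivPow F (p ^ n₁) (p ^ n₂)) β = b at *
  generalize algebraMap F (DivPow F (p ^ n₁) (p ^ n₂)) π = q at *
  obtain rfl : M = J + K - 1 := by linear_combination -el
  -- the three products of the `x`-parts that occur in the bracket
  have f1 : (A + q * J * x) * (b * B - (q * b + (1 - K)) * x + q * K * w) =
      b * E + q * K * w + x * (-(q * b + (1 - K)) + q * J * b - q * K * a) := by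
    linear_combination b * e1 - (q * b + (1 - K)) * e2 + q * K * e4 + q * J * b * e3
      - q * J * (q * b + (1 - K)) * e6 + q * J * q * K * e7
  have f2 : (B + q * K * x) * (a * A - (q * a + (1 - J)) * x + q * J * w) =
      a * E + q * J * w + x * (-(q * a + (1 - J)) + q * K * a - q * J * b) := by
    linear_combination a * e1 - (q * a + (1 - J)) * e3 + q * J * e5 + q * K * a * e2
      - q * K * (q * a + (1 - J)) * e6 + q * J * q * K * e7
  have f3 : x * ((A + q * J * x) * (B + q * K * x)) = x := by
    linear_combination (B + q * K * x) * e2 + q * J * (B + q * K * x) * e6 + e3 + q * K * e6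
  linear_combination (yj' * yk) * f1 - (yk' * yj) * f2 + (yj' * yk - yk' * yj) * f3
    + (b * E + q * K * w + x * (-(q * b + (1 - K)) + q * J * b - q * K * a) + x) * e8
    - (a * E + q * J * w + x * (-(q * a + (1 - J)) + q * K * a - q * J * b) + x) * e9
    + (q * w + x - q * x * a - q * x * b) * yl * ec

/-- The structure constants on the vectors `e_{1-j, α}`. -/
theorem lie_eigvec_eigvec (hn₁ : 3 ≤ p ^ n₁) (π : F) {j k l : ℕ} (h : j + k = l + 1)
    (hj : j < p ^ n₂) (hk : k < p ^ n₂) {α β : F} (hα : α ^ p ^ n₁ = π * α + (1 - j))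
    (hβ : β ^ p ^ n₁ = π * β + (1 - k)) :
    ⁅eigvec p n₁ n₂ π j α, eigvec p n₁ n₂ π k β⁆ =
      ((l.choose k : F) * β - (l.choose j : F) * α) • eigvec p n₁ n₂ π l (α + β) := by
  rw [← eigvecProd_eq_eigvec, ← eigvecProd_eq_eigvec, ← eigvecProd_eq_eigvec]
  exact poisson_eigvecProd hn₁ π h hj hk hα hβ

theorem lie_eigvec_zero_eigvec_zero (π α β : F) :
    ⁅eigvec p n₁ n₂ π 0 α, eigvec p n₁ n₂ π 0 β⁆ = 0 := by
  have hs : 1 ≤ p ^ n₂ := Nat.one_le_pow _ _ (Fact.out : p.Prime).pos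
  have h : poisson (eigvecProd (p ^ n₁) (p ^ n₂) π 0 α) (eigvecProd (p ^ n₁) (p ^ n₂) π 0 β)
      = 0 := by
    rw [eigvecProd, eigvecProd, poisson]
    simp [d2_mul, d2_expX hs, d2_mon_zero hs]
  rw [← eigvecProd_eq_eigvec, ← eigvecProd_eq_eigvec]
  exact h

end Ham

/-! ### Loop algebras of cyclically graded Lie algebras -/

section Loop

open Polynomial

variable {F L : Type*} [Field F] [LieRing L] [LieAlgebra F L]

/-- A grading of which each component contains the corresponding component of another grading is
equal to it. -/
theorem eq_of_forall_le_of_isInternal {ι M : Type*} [DecidableEq ι] [AddCommGroup M] [Module F M]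
    {A B : ι → Submodule F M} (hA : DirectSum.IsInternal A) (hB : DirectSum.IsInternal B)
    (h : ∀ i, A i ≤ B i) : A = B := by
  funext i
  refine le_antisymm (h i) fun x hx => ?_
  have htop : x ∈ A i ⊔ ⨆ j ≠ i, A j := by
    rw [← iSup_split_single A i, hA.submodule_iSup_eq_top]; trivial
  obtain ⟨a, ha, c, hc, rfl⟩ := Submodule.mem_sup.mp htop
  have hc' : c ∈ ⨆ j ≠ i, B j := iSup₂_mono (fun j _ => h j) hc
  have hcB : c ∈ B i := by simpa using (B i).sub_mem hx (h i ha)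
  have hc0 : c = 0 := Submodule.disjoint_def.mp (hB.submodule_iSupIndep i) c hcB hc'
  simpa [hc0] using ha

/-- The coefficient of `t^k` of an element of `F[t] ⊗ L`. -/
def loopCoeff (k : ℕ) : F[X] ⊗[F] L →ₗ[F] L :=
  (TensorProduct.lid F L).toLinearMap ∘ₗ (Polynomial.lcoeff F k).rTensor L

theorem loopCoeff_tmul (k l : ℕ) (u : L) :
    loopCoeff k (((X : F[X]) ^ l) ⊗ₜ[F] u) = if k = l then u else 0 := by
  simp [loopCoeff, coeff_X_pow]

variable {m : ℕ}

/-- The span of the vectors `t^k ⊗ u`, with `k ≥ 1` and `u` in the component of degree `k`. -/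
def loopSpan (𝓖 : ZMod m → Submodule F L) : Submodule F (F[X] ⊗[F] L) :=
  Submodule.span F {z | ∃ k : ℕ, 1 ≤ k ∧ ∃ u ∈ 𝓖 k, ((X : F[X]) ^ k) ⊗ₜ[F] u = z}

theorem loopAlgebra_le_loopSpan {𝓖 : ZMod m → Submodule F L} (h𝓖 : IsLieGrading 𝓖) :
    (loopAlgebra (𝓖 1)).toSubmodule ≤ loopSpan 𝓖 := by
  let W : LieSubalgebra F (F[X] ⊗[F] L) :=
    { loopSpan 𝓖 with
      lie_mem' := by
        intro x y hx hy
        change x ∈ loopSpan 𝓖 at hx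
        change y ∈ loopSpan 𝓖 at hy
        change ⁅x, y⁆ ∈ loopSpan 𝓖
        induction hx, hy using Submodule.span_induction₂ with
        | mem_mem x y hx hy =>
          obtain ⟨k, hk, u, hu, rfl⟩ := hx
          obtain ⟨l, hl, v, hv, rfl⟩ := hy
          refine Submodule.subset_span ⟨k + l, by omega, ⁅u, v⁆, ?_, ?_⟩
          · rw [Nat.cast_add]
            exact h𝓖.bracket_mem _ _ _ hu _ hv
          · rw [pow_add]
            exact (LieAlgebra.ExtendScalars.bracket_tmul F F[X] L L _ _ _ _).symm
        | zero_left y _ => exact (zero_lie (L := F[X] ⊗[F] L) y).symm ▸ zero_mem _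
        | zero_right x _ =>
          exact (lie_zero (L := F[X] ⊗[F] L) (M := F[X] ⊗[F] L) x).symm ▸ zero_mem _
        | add_left x y z _ _ _ h1 h2 => exact (add_lie x y z).symm ▸ add_mem h1 h2
        | add_right x y z _ _ _ h1 h2 => exact (lie_add x y z).symm ▸ add_mem h1 h2
        | smul_left c x y _ _ h => exact (smul_lie c x y).symm ▸ Submodule.smul_mem _ _ h
        | smul_right c x y _ _ h => exact (lie_smul c x y).symm ▸ Submodule.smul_mem _ _ h }
  have h : loopAlgebra (𝓖 1) ≤ W := by
    refine LieSubalgebra.lieSpan_le.mpr ?_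
    rintro z ⟨u, hu, rfl⟩
    exact Submodule.subset_span ⟨1, le_rfl, u, by simpa using hu, by rw [pow_one]⟩
  exact h

/-- The covering property of thin Lie algebras, for a grading over `ℤ/mℤ`. -/
def CyclicCovering (𝓖 : ZMod m → Submodule F L) : Prop :=
  ∀ k, ∀ u ∈ 𝓖 k, u ≠ 0 → ∀ w ∈ 𝓖 (k + 1), ∃ v ∈ 𝓖 1, ⁅u, v⁆ = w

/-- In a grading with the covering property, every component is reached from `𝓖 1` by bracketing
repeatedly with `𝓖 1`. -/
theorem CyclicCovering.le_of_lie_mem {𝓖 : ZMod m → Submodule F L} (hcov : CyclicCovering 𝓖)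
    (hne : ∀ k, 𝓖 k ≠ ⊥) {𝓢 : ℕ → Submodule F L} (h1 : 𝓖 1 ≤ 𝓢 1)
    (hs : ∀ k, 1 ≤ k → ∀ u ∈ 𝓢 k, ∀ v ∈ 𝓖 1, ⁅u, v⁆ ∈ 𝓢 (k + 1)) (k : ℕ) (hk : 1 ≤ k) :
    𝓖 k ≤ 𝓢 k := by
  induction k, hk using Nat.le_induction with
  | base => simpa using h1
  | succ k hk ih =>
    intro w hw
    obtain ⟨u, hu, hu0⟩ := Submodule.exists_mem_ne_zero_of_ne_bot (hne k)
    obtain ⟨v, hv, rfl⟩ := hcov k u hu hu0 w (by simpa using hw)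
    exact hs k hk u (ih hu) v hv

theorem exists_natCast_eq [NeZero m] (a : ZMod m) : ∃ k : ℕ, 1 ≤ k ∧ (k : ZMod m) = a :=
  ⟨a.val + m, by have := NeZero.pos m; omega, by simp⟩

theorem CyclicCovering.lieSpan_eq_top [NeZero m] {𝓖 : ZMod m → Submodule F L}
    (h𝓖 : IsLieGrading 𝓖) (hcov : CyclicCovering 𝓖) (hne : ∀ k, 𝓖 k ≠ ⊥) {S : Set L}
    (hS : 𝓖 1 = Submodule.span F S) : LieSubalgebra.lieSpan F L S = ⊤ := by
  have h1 : 𝓖 1 ≤ (LieSubalgebra.lieSpan F L S).toSubmodule := by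
    rw [hS]
    exact LieSubalgebra.submodule_span_le_lieSpan
  have h := hcov.le_of_lie_mem hne (𝓢 := fun _ => (LieSubalgebra.lieSpan F L S).toSubmodule) h1
    fun k _ u hu v hv => LieSubalgebra.lie_mem _ hu (h1 hv)
  rw [← LieSubalgebra.toSubmodule_eq_top, eq_top_iff, ← h𝓖.isInternal.submodule_iSup_eq_top]
  refine iSup_le fun a => ?_
  obtain ⟨k, hk, rfl⟩ := exists_natCast_eq a
  exact h k hk

theorem CyclicCovering.eq_of_isLieGrading [NeZero m] {𝓖 𝓖' : ZMod m → Submodule F L}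
    (h𝓖 : IsLieGrading 𝓖) (hcov : CyclicCovering 𝓖) (hne : ∀ k, 𝓖 k ≠ ⊥)
    (h𝓖' : IsLieGrading 𝓖') (h1 : 𝓖 1 ≤ 𝓖' 1) : 𝓖' = 𝓖 := by
  refine (eq_of_forall_le_of_isInternal h𝓖.isInternal h𝓖'.isInternal fun a => ?_).symm
  obtain ⟨k, hk, rfl⟩ := exists_natCast_eq a
  refine hcov.le_of_lie_mem hne (𝓢 := fun k => 𝓖' k) (by simpa using h1) ?_ k hk
  intro k _ u hu v hv
  have := h𝓖'.bracket_mem _ _ u hu v (h1 hv)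
  simpa using this

theorem CyclicCovering.tmul_mem_loopAlgebra {𝓖 : ZMod m → Submodule F L}
    (hcov : CyclicCovering 𝓖) (hne : ∀ k, 𝓖 k ≠ ⊥) {k : ℕ} (hk : 1 ≤ k) {u : L} (hu : u ∈ 𝓖 k) :
    ((X : F[X]) ^ k) ⊗ₜ[F] u ∈ loopAlgebra (𝓖 1) := by
  refine hcov.le_of_lie_mem hne (𝓢 := fun k => (loopAlgebra (𝓖 1)).toSubmodule.comap
    (TensorProduct.mk F F[X] L (X ^ k))) ?_ ?_ k hk hu
  · intro v hv
    simp only [Submodule.mem_comap, TensorProduct.mk_apply, pow_one]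
    exact LieSubalgebra.subset_lieSpan ⟨v, hv, rfl⟩
  · intro k _ u hu v hv
    have h := LieSubalgebra.lie_mem _ hu
      (LieSubalgebra.subset_lieSpan ⟨v, hv, rfl⟩ : (X : F[X]) ⊗ₜ[F] v ∈ loopAlgebra (𝓖 1))
    rwa [TensorProduct.mk_apply, LieAlgebra.ExtendScalars.bracket_tmul, ← pow_succ] at h

theorem loopCoeff_mem {𝓖 : ZMod m → Submodule F L} (h𝓖 : IsLieGrading 𝓖)
    {z : F[X] ⊗[F] L} (hz : z ∈ loopAlgebra (𝓖 1)) (k : ℕ) : loopCoeff k z ∈ 𝓖 k := by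
  have h := loopAlgebra_le_loopSpan h𝓖 hz
  revert h
  suffices H : loopSpan 𝓖 ≤ (𝓖 k).comap (loopCoeff k) from fun h => H h
  refine Submodule.span_le.mpr ?_
  rintro _ ⟨l, _, u, hu, rfl⟩
  simp only [SetLike.mem_coe, Submodule.mem_comap, loopCoeff_tmul]
  split_ifs with h
  · rwa [h]
  · exact zero_mem _

theorem loopCoeff_zero {𝓖 : ZMod m → Submodule F L} (h𝓖 : IsLieGrading 𝓖)
    {z : F[X] ⊗[F] L} (hz : z ∈ loopAlgebra (𝓖 1)) : loopCoeff 0 z = 0 := by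
  have h := loopAlgebra_le_loopSpan h𝓖 hz
  revert h
  suffices H : loopSpan 𝓖 ≤ LinearMap.ker (loopCoeff 0) from fun h => H h
  refine Submodule.span_le.mpr ?_
  rintro _ ⟨l, hl, u, hu, rfl⟩
  simp only [SetLike.mem_coe, LinearMap.mem_ker, loopCoeff_tmul]
  rw [if_neg (by omega)]

theorem eq_tmul_loopCoeff {U : Submodule F L} {k : ℕ} {z : loopAlgebra U}
    (hz : z ∈ loopComponent U k) : (z : F[X] ⊗[F] L) = (X ^ k) ⊗ₜ[F] loopCoeff k z.1 := by
  obtain ⟨u, hu⟩ := hz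
  simp only [TensorProduct.mk_apply] at hu
  change _ = z.1 at hu
  rw [← hu, loopCoeff_tmul, if_pos rfl]

theorem lie_mem_loopComponent {U : Submodule F L} {k l : ℕ} {x y : loopAlgebra U}
    (hx : x ∈ loopComponent U k) (hy : y ∈ loopComponent U l) :
    ⁅x, y⁆ ∈ loopComponent U (k + l) := by
  refine ⟨⁅loopCoeff k x.1, loopCoeff l y.1⁆, ?_⟩
  change _ = ⁅x.1, y.1⁆
  rw [eq_tmul_loopCoeff hx, eq_tmul_loopCoeff hy, LieAlgebra.ExtendScalars.bracket_tmul,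
    ← eq_tmul_loopCoeff hx, ← eq_tmul_loopCoeff hy, pow_add]
  rfl

theorem loopComponent_zero {𝓖 : ZMod m → Submodule F L} (h𝓖 : IsLieGrading 𝓖) :
    loopComponent (𝓖 1) 0 = ⊥ := by
  refine (Submodule.eq_bot_iff _).mpr fun z hz => ?_
  have h := eq_tmul_loopCoeff hz
  rw [loopCoeff_zero h𝓖 z.2, TensorProduct.tmul_zero] at h
  exact Subtype.ext h

/-- The map `u ↦ t^k ⊗ u` from the component of degree `k` to the loop algebra. -/
def loopMk {𝓖 : ZMod m → Submodule F L} (hcov : CyclicCovering 𝓖) (hne : ∀ k, 𝓖 k ≠ ⊥)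
    {k : ℕ} (hk : 1 ≤ k) : 𝓖 k →ₗ[F] loopAlgebra (𝓖 1) :=
  LinearMap.codRestrict (loopAlgebra (𝓖 1)).toSubmodule
    (TensorProduct.mk F F[X] L (X ^ k) ∘ₗ (𝓖 k).subtype)
    fun u => hcov.tmul_mem_loopAlgebra hne hk u.2

theorem coe_loopMk {𝓖 : ZMod m → Submodule F L} (hcov : CyclicCovering 𝓖) (hne : ∀ k, 𝓖 k ≠ ⊥)
    {k : ℕ} (hk : 1 ≤ k) (u : 𝓖 k) :
    (loopMk hcov hne hk u : F[X] ⊗[F] L) = (X ^ k) ⊗ₜ[F] (u : L) := rfl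

theorem loopMk_injective {𝓖 : ZMod m → Submodule F L} (hcov : CyclicCovering 𝓖)
    (hne : ∀ k, 𝓖 k ≠ ⊥) {k : ℕ} (hk : 1 ≤ k) : Function.Injective (loopMk hcov hne hk) := by
  intro u v huv
  have h := congrArg (fun z : loopAlgebra (𝓖 1) => loopCoeff k z.1) huv
  simp only [coe_loopMk, loopCoeff_tmul, if_true] at h
  exact Subtype.ext h

theorem range_loopMk {𝓖 : ZMod m → Submodule F L} (h𝓖 : IsLieGrading 𝓖)
    (hcov : CyclicCovering 𝓖) (hne : ∀ k, 𝓖 k ≠ ⊥) {k : ℕ} (hk : 1 ≤ k) :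
    LinearMap.range (loopMk hcov hne hk) = loopComponent (𝓖 1) k := by
  ext z
  constructor
  · rintro ⟨u, rfl⟩
    exact ⟨u, rfl⟩
  · intro hz
    exact ⟨⟨_, loopCoeff_mem h𝓖 z.2 k⟩, Subtype.ext (eq_tmul_loopCoeff hz).symm⟩

theorem finrank_loopComponent {𝓖 : ZMod m → Submodule F L} (h𝓖 : IsLieGrading 𝓖)
    (hcov : CyclicCovering 𝓖) (hne : ∀ k, 𝓖 k ≠ ⊥) {k : ℕ} (hk : 1 ≤ k) :
    Module.finrank F (loopComponent (𝓖 1) k) = Module.finrank F (𝓖 k) := by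
  rw [← range_loopMk h𝓖 hcov hne hk]
  exact LinearMap.finrank_range_of_inj (loopMk_injective hcov hne hk)

theorem loopComponent_isLieGrading {𝓖 : ZMod m → Submodule F L} (h𝓖 : IsLieGrading 𝓖)
    (hcov : CyclicCovering 𝓖) (hne : ∀ k, 𝓖 k ≠ ⊥) : IsLieGrading (loopComponent (𝓖 1)) where
  bracket_mem _ _ _ hx _ hy := lie_mem_loopComponent hx hy
  isInternal := by
    refine DirectSum.isInternal_submodule_of_iSupIndep_of_iSup_eq_top ?_ ?_
    · intro k
      refine Submodule.disjoint_def.mpr fun z hz hz' => ?_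
      have h : (⨆ l ≠ k, loopComponent (𝓖 1) l) ≤
          LinearMap.ker (loopCoeff k ∘ₗ (loopAlgebra (𝓖 1)).toSubmodule.subtype) := by
        refine iSup₂_le fun l hl y hy => ?_
        have := eq_tmul_loopCoeff hy
        change loopCoeff k y.1 = 0
        rw [this, loopCoeff_tmul, if_neg (Ne.symm hl)]
      have h0 : loopCoeff k z.1 = 0 := h hz'
      have h1 := eq_tmul_loopCoeff hz
      rw [h0, TensorProduct.tmul_zero] at h1
      exact Subtype.ext h1
    · rw [eq_top_iff]
      rintro z -
      have h : (loopAlgebra (𝓖 1)).toSubmodule ≤ (⨆ k, loopComponent (𝓖 1) k).map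
          (loopAlgebra (𝓖 1)).toSubmodule.subtype := by
        refine (loopAlgebra_le_loopSpan h𝓖).trans (Submodule.span_le.mpr ?_)
        rintro _ ⟨k, hk, u, hu, rfl⟩
        exact ⟨loopMk hcov hne hk ⟨u, hu⟩, Submodule.mem_iSup_of_mem k ⟨u, rfl⟩, rfl⟩
      obtain ⟨y, hy, hyz⟩ := h z.2
      rwa [← Subtype.ext (a1 := y) (a2 := z) hyz]

/-- A cyclic grading with the covering property has a thin loop algebra, whose components of
positive degree are copies of those of the grading. -/
theorem loopComponent_isThin [NeZero m] {𝓖 : ZMod m → Submodule F L} (h𝓖 : IsLieGrading 𝓖)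
    (hcov : CyclicCovering 𝓖) (hne : ∀ k, 𝓖 k ≠ ⊥) (h2 : Module.finrank F (𝓖 1) = 2) :
    IsThin (loopComponent (𝓖 1)) where
  isLieGrading := loopComponent_isLieGrading h𝓖 hcov hne
  zero := loopComponent_zero h𝓖
  finrank_one := by
    rw [finrank_loopComponent h𝓖 hcov hne le_rfl, Nat.cast_one, h2]
  covering k hk u hu hu0 w hw := by
    rw [← range_loopMk h𝓖 hcov hne hk] at hu
    rw [← range_loopMk h𝓖 hcov hne (by omega)] at hw
    obtain ⟨u, rfl⟩ := hu
    obtain ⟨w, rfl⟩ := hw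
    obtain ⟨v, hv, hvw⟩ := hcov k u.1 u.2 (fun h => hu0 (by
      rw [Subtype.ext (a1 := u) (a2 := 0) h, map_zero])) w.1 (by
        simpa only [Nat.cast_add, Nat.cast_one] using w.2)
    refine ⟨loopGen _ v hv, ⟨v, by rw [pow_one]; rfl⟩, Subtype.ext ?_⟩
    change ⁅((X : F[X]) ^ k) ⊗ₜ[F] (u : L), X ⊗ₜ[F] v⁆ = (X ^ (k + 1)) ⊗ₜ[F] (w : L)
    rw [LieAlgebra.ExtendScalars.bracket_tmul, hvw, pow_succ]
  infinite hfin := by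
    have hind := (loopComponent_isLieGrading h𝓖 hcov hne).isInternal.submodule_iSupIndep
    have hfinite := WellFoundedGT.finite_ne_bot_of_iSupIndep hind
    refine Set.infinite_of_injective_forall_mem (f := fun k : ℕ => k + 1)
      (fun a b h => by simpa using h) (fun k => ?_) hfinite
    intro h
    rw [← range_loopMk h𝓖 hcov hne (by omega), LinearMap.range_eq_bot] at h
    obtain ⟨u, hu, hu0⟩ := Submodule.exists_mem_ne_zero_of_ne_bot (hne ((k + 1 : ℕ) : ZMod m))
    refine hu0 (congrArg Subtype.val (loopMk_injective hcov hne (by omega)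
      (a₁ := (⟨u, hu⟩ : 𝓖 ((k + 1 : ℕ) : ZMod m))) (a₂ := 0) ?_))
    rw [h, map_zero]
    rfl
  exists_diamond := by
    refine ⟨1 + m, by have := NeZero.pos m; omega, ?_⟩
    rw [finrank_loopComponent h𝓖 hcov hne (by omega), Nat.cast_add, Nat.cast_one,
      CharP.cast_eq_zero, add_zero, h2]

end Loop

/-! ### The eigenvectors indexed by integers -/

section Eigenvectors

open Ham

variable {F : Type*} [Field F] {p n : ℕ} {σ ρ : F}

/-- The vector `e_{1-j, α}` of `H(2; (1, n); Φ(1))` with `α = (1 - j) ρ + s σ` and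
`π = σ^(p-1)`. -/
def ev (p n : ℕ) (σ ρ : F) (j : ℕ) (s : ℤ) : Ham F p 1 n :=
  eigvec p 1 n (σ ^ (p - 1)) j ((1 - (j : F)) * ρ + (s : F) * σ)

theorem ev_congr [CharP F p] {s t : ℤ} (h : s ≡ t [ZMOD p]) (j : ℕ) :
    ev p n σ ρ j s = ev p n σ ρ j t := by
  rw [ev, ev, (CharP.intCast_eq_intCast F p).mpr h]

theorem ev_eq_zero {j : ℕ} (hj : p ^ n ≤ j) (s : ℤ) : ev p n σ ρ j s = 0 :=
  eigvec_eq_zero _ hj _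

theorem eigvec_eq_genX : eigvec p 1 n (σ ^ (p - 1)) 0 (ρ + σ) = genX p n σ ρ := by
  simp [eigvec, genX]

theorem ev_zero_one : ev p n σ ρ 0 1 = genX p n σ ρ := by
  rw [← eigvec_eq_genX, ev]
  congr 1
  simp

theorem finrank_ham : Module.finrank F (Ham F p 1 n) = p ^ n * p := by
  refine (Module.finrank_eq_card_basis (DivPow.basis F (p ^ 1) (p ^ n))).trans ?_
  simp [mul_comm]

variable [hpp : Fact p.Prime] [CharP F p]

theorem intCast_pow_char (c : ℤ) : (c : F) ^ p = c :=
  map_intCast (frobenius F p) c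

/-- The scalars `(1 - j) ρ + s σ` satisfy the condition under which the bracket of eigenvectors was
computed. -/
theorem root_pow (hρ : ρ ^ p - σ ^ (p - 1) * ρ - 1 = 0) (j : ℕ) (s : ℤ) :
    ((1 - (j : F)) * ρ + (s : F) * σ) ^ p =
      σ ^ (p - 1) * ((1 - (j : F)) * ρ + (s : F) * σ) + (1 - j) := by
  have h1 : (1 - (j : F)) ^ p = 1 - j := by
    have := intCast_pow_char (F := F) (p := p) (1 - j)
    simpa using this
  have h2 : σ ^ p = σ ^ (p - 1) * σ := by
    rw [← pow_succ, Nat.sub_add_cancel hpp.out.one_le]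
  rw [add_pow_char, mul_pow, mul_pow, h1, intCast_pow_char, h2]
  linear_combination (1 - (j : F)) * hρ

theorem root_ne_zero (hρ : ρ ^ p - σ ^ (p - 1) * ρ - 1 = 0) {j : ℕ} (hj : 1 - (j : F) ≠ 0)
    (s : ℤ) : (1 - (j : F)) * ρ + (s : F) * σ ≠ 0 := by
  intro h
  have := root_pow hρ j s
  rw [h, zero_pow hpp.out.ne_zero, mul_zero, zero_add] at this
  exact hj this.symm

theorem add_intCast_mul_ne_zero (hρ : ρ ^ p - σ ^ (p - 1) * ρ - 1 = 0) (s : ℤ) :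
    ρ + (s : F) * σ ≠ 0 := by
  simpa using root_ne_zero (j := 0) hρ (by simp) s

theorem rho_ne_zero (hρ : ρ ^ p - σ ^ (p - 1) * ρ - 1 = 0) : ρ ≠ 0 := by
  simpa using add_intCast_mul_ne_zero hρ 0

theorem natCast_pow_sub_one (hn : 0 < n) : ((p ^ n - 1 : ℕ) : F) = -1 := by
  rw [Nat.cast_sub (Nat.one_le_pow _ _ hpp.out.pos)]
  simp [hn.ne']

theorem three_le_pow (hp : Odd p) (hn : 0 < n) : 3 ≤ p ^ n := by
  have h2 := hpp.out.two_le
  have h3 : 3 ≤ p := by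
    rcases hp with ⟨k, rfl⟩; omega
  exact h3.trans (Nat.le_self_pow hn.ne' p)

theorem two_ne_zero_of_odd (hp : Odd p) : (2 : F) ≠ 0 := by
  have := (CharP.cast_eq_zero_iff F p 2).not.mpr fun h => by
    have h1 := (Nat.prime_dvd_prime_iff_eq hpp.out Nat.prime_two).mp h
    subst h1
    exact absurd hp (by decide)
  exact_mod_cast this

theorem two_mul_add_intCast_mul_ne_zero (hp : Odd p) (hρ : ρ ^ p - σ ^ (p - 1) * ρ - 1 = 0)
    (s : ℤ) : 2 * ρ + (s : F) * σ ≠ 0 := by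
  have h := root_ne_zero (j := p ^ 1 - 1) hρ
    (by rw [natCast_pow_sub_one one_pos, sub_neg_eq_add, one_add_one_eq_two]
        exact two_ne_zero_of_odd hp) s
  rwa [natCast_pow_sub_one one_pos, sub_neg_eq_add, one_add_one_eq_two] at h

theorem eigvec_eq_genY (hn : 0 < n) :
    eigvec p 1 n (σ ^ (p - 1)) (p ^ n - 1) (2 * ρ + σ) = genY p n σ ρ := by
  simp [eigvec, genY, natCast_pow_sub_one hn]

theorem ev_sub_one_one (hn : 0 < n) : ev p n σ ρ (p ^ n - 1) 1 = genY p n σ ρ := by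
  rw [← eigvec_eq_genY hn, ev, natCast_pow_sub_one hn]
  congr 1
  push_cast
  ring

theorem lie_ev_ev (hp : Odd p) (hρ : ρ ^ p - σ ^ (p - 1) * ρ - 1 = 0) {j k l : ℕ}
    (h : j + k = l + 1) (hj : j < p ^ n) (hk : k < p ^ n) (s t : ℤ) :
    ⁅ev p n σ ρ j s, ev p n σ ρ k t⁆ =
      ((l.choose k : F) * ((1 - (k : F)) * ρ + (t : F) * σ) -
        (l.choose j : F) * ((1 - (j : F)) * ρ + (s : F) * σ)) • ev p n σ ρ l (s + t) := by
  rw [ev, ev, lie_eigvec_eigvec (three_le_pow hp one_pos) _ h hj hk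
    (by rw [pow_one]; exact root_pow hρ j s) (by rw [pow_one]; exact root_pow hρ k t), ev]
  congr 2
  have : (j : F) + k = l + 1 := by rw [← Nat.cast_add, h, Nat.cast_succ]
  push_cast
  linear_combination -ρ * this

theorem lie_ev_zero_ev_zero (s t : ℤ) : ⁅ev p n σ ρ 0 s, ev p n σ ρ 0 t⁆ = 0 :=
  lie_eigvec_zero_eigvec_zero _ _ _

theorem lie_e₀_ev (hp : Odd p) (hn : 0 < n) (hρ : ρ ^ p - σ ^ (p - 1) * ρ - 1 = 0) {j : ℕ}
    (hj : j < p ^ n) (s : ℤ) : ⁅e₀ p 1 n (σ ^ (p - 1)), ev p n σ ρ j s⁆ =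
      ((1 - (j : F)) * ρ + (s : F) * σ) • ev p n σ ρ j s := by
  have h3 := three_le_pow hp hn
  have h : e₀ p 1 n (σ ^ (p - 1)) = ev p n σ ρ 1 0 := by
    rw [e₀_eq_eigvec, ev]
    simp
  rw [h, lie_ev_ev hp hρ (add_comm 1 j) (by omega) hj, zero_add]
  simp

theorem lie_ev_succ_genX (hp : Odd p) (hρ : ρ ^ p - σ ^ (p - 1) * ρ - 1 = 0) {j : ℕ}
    (hj : j + 1 < p ^ n) (s : ℤ) :
    ⁅ev p n σ ρ (j + 1) s, genX p n σ ρ⁆ = (ρ + σ) • ev p n σ ρ j (s + 1) := by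
  rw [← ev_zero_one, lie_ev_ev hp hρ (add_zero (j + 1)) hj (by omega)]
  simp

theorem lie_ev_zero_genX (s : ℤ) : ⁅ev p n σ ρ 0 s, genX p n σ ρ⁆ = 0 := by
  rw [← ev_zero_one, lie_ev_zero_ev_zero]

theorem lie_ev_one_genY (hp : Odd p) (hn : 0 < n) (hρ : ρ ^ p - σ ^ (p - 1) * ρ - 1 = 0)
    (s : ℤ) : ⁅ev p n σ ρ 1 s, genY p n σ ρ⁆ =
      (2 * ρ + ((s + 1 : ℤ) : F) * σ) • ev p n σ ρ (p ^ n - 1) (s + 1) := by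
  have h3 := three_le_pow hp hn
  rw [← ev_sub_one_one hn, lie_ev_ev hp hρ (add_comm 1 _) (by omega) (by omega),
    Nat.choose_self, Nat.choose_one_right, natCast_pow_sub_one hn]
  congr 1
  push_cast
  ring

theorem lie_ev_zero_genY (hp : Odd p) (hn : 0 < n) (hρ : ρ ^ p - σ ^ (p - 1) * ρ - 1 = 0)
    (s : ℤ) : ⁅ev p n σ ρ 0 s, genY p n σ ρ⁆ =
      (-(ρ + (s : F) * σ)) • ev p n σ ρ (p ^ n - 2) (s + 1) := by
  have h3 := three_le_pow hp hn
  rw [← ev_sub_one_one hn, lie_ev_ev hp hρ (l := p ^ n - 2) (by omega) (by omega) (by omega),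
    Nat.choose_eq_zero_of_lt (by omega), Nat.choose_zero_right]
  congr 1
  push_cast
  ring

theorem lie_ev_genY_of_two_le (hp : Odd p) (hn : 0 < n) (hρ : ρ ^ p - σ ^ (p - 1) * ρ - 1 = 0)
    {j : ℕ} (hj2 : 2 ≤ j) (hj : j < p ^ n) (s : ℤ) : ⁅ev p n σ ρ j s, genY p n σ ρ⁆ = 0 := by
  have h3 := three_le_pow hp hn
  rw [← ev_sub_one_one hn, lie_ev_ev hp hρ (l := j + p ^ n - 2) (by omega) hj (by omega),
    ev_eq_zero (j := j + p ^ n - 2) (by omega), smul_zero]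

theorem repr_eigvecProd {r s : ℕ} (π : F) {j : ℕ} (hj : j < s) (α : F) (a : Fin r × Fin s) :
    (DivPow.basis F r s).repr (eigvecProd r s π j α) a =
      if (a.2 : ℕ) = j then (if (a.1 : ℕ) = r - 1 then π * j else 0) + α ^ (a.1 : ℕ) else 0 := by
  have hmon : ∀ i, i < r → (DivPow.basis F r s).repr (DivPow.mon F r s i j) a =
      if (a.2 : ℕ) = j then (if (a.1 : ℕ) = i then 1 else 0) else 0 := by
    intro i hi
    rw [DivPow.mon, dif_pos ⟨hi, hj⟩, Module.Basis.repr_self, Finsupp.single_apply]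
    simp only [Prod.ext_iff, Fin.ext_iff, eq_comm (a := i), eq_comm (a := j)]
    split_ifs <;> simp_all
  have ha := a.1.isLt
  rw [eigvecProd_eq]
  simp only [map_add, map_smul, map_sum, Finsupp.add_apply, Finsupp.smul_apply,
    Finsupp.finsetSum_apply, smul_eq_mul]
  rw [hmon _ (by omega), Finset.sum_congr rfl fun i hi => by
    rw [hmon i (Finset.mem_range.mp hi)]]
  split_ifs <;> simp

theorem linearIndependent_ev (hσ : σ ≠ 0) :
    LinearIndependent F fun a : Fin (p ^ n) × Fin p => ev p n σ ρ a.1 (a.2 : ℕ) := by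
  rw [Fintype.linearIndependent_iff]
  intro g hg
  have hp2 := hpp.out.two_le
  have hcoeff : ∀ (j : Fin (p ^ n)) (i : Fin p), ∑ s : Fin p, g (j, s) *
      ((if (i : ℕ) = p - 1 then σ ^ (p - 1) * (j : ℕ) else 0) +
        ((1 - ((j : ℕ) : F)) * ρ + ((s : ℕ) : F) * σ) ^ (i : ℕ)) = 0 := by
    intro j i
    have h : (DivPow.basis F (p ^ 1) (p ^ n)).repr (∑ a : Fin (p ^ n) × Fin p, g a •
        eigvecProd (p ^ 1) (p ^ n) (σ ^ (p - 1)) a.1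
          ((1 - ((a.1 : ℕ) : F)) * ρ + ((a.2 : ℕ) : F) * σ)) (⟨i, by simp⟩, j) = 0 := by
      have : (∑ a : Fin (p ^ n) × Fin p, g a •
        eigvecProd (p ^ 1) (p ^ n) (σ ^ (p - 1)) a.1
          ((1 - ((a.1 : ℕ) : F)) * ρ + ((a.2 : ℕ) : F) * σ)) = 0 := by
        refine Eq.trans (Finset.sum_congr rfl fun a _ => ?_) hg
        rw [eigvecProd_eq_eigvec, ev, Int.cast_natCast]
        rfl
      rw [this, map_zero]
      rfl
    rw [map_sum, Finsupp.finsetSum_apply, Fintype.sum_prod_type] at h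
    rw [Finset.sum_eq_single j] at h
    · refine Eq.trans (Finset.sum_congr rfl fun s _ => ?_) h
      rw [map_smul, Finsupp.smul_apply, repr_eigvecProd _ j.isLt, if_pos rfl, smul_eq_mul]
      simp only [pow_one]
    · intro k _ hk
      refine Finset.sum_eq_zero fun s _ => ?_
      rw [map_smul, Finsupp.smul_apply, repr_eigvecProd _ k.isLt,
        if_neg (fun h => hk (Fin.ext h.symm)), smul_zero]
    · exact fun h => absurd (Finset.mem_univ j) h
  rintro ⟨j, s⟩
  -- the coefficients of `y^(j)` show that the correction terms at `x̄ y^(j)` add up to zero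
  have hsum : ∑ s : Fin p, g (j, s) = 0 := by
    have := hcoeff j ⟨0, by omega⟩
    simpa [show ¬ (0 = p - 1) by omega] using this
  refine congrFun (Matrix.eq_zero_of_forall_pow_sum_mul_pow_eq_zero
    (f := fun s : Fin p => (1 - ((j : ℕ) : F)) * ρ + ((s : ℕ) : F) * σ)
    (v := fun s => g (j, s)) ?_ ?_) s
  · intro s t hst
    have h1 : ((s : ℕ) : F) = (t : ℕ) := by simpa [hσ] using hst
    exact Fin.ext (CharP.natCast_injOn_Iio F p s.isLt t.isLt h1)
  · intro i
    have h := hcoeff j i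
    simp only [mul_add, Finset.sum_add_distrib, ← Finset.sum_mul, hsum, zero_mul, zero_add] at h
    exact h

/-- The basis of `H(2; (1, n); Φ(1))` formed by the vectors `e_{1-j, α}`. -/
def evBasis (p n : ℕ) [Fact p.Prime] [CharP F p] {σ : F} (ρ : F) (hσ : σ ≠ 0) :
    Module.Basis (Fin (p ^ n) × Fin p) F (Ham F p 1 n) :=
  haveI : NeZero p := ⟨(Fact.out : p.Prime).ne_zero⟩
  basisOfLinearIndependentOfCardEqFinrank (linearIndependent_ev (ρ := ρ) hσ) (by simp [finrank_ham])

theorem evBasis_apply (hσ : σ ≠ 0) (a : Fin (p ^ n) × Fin p) :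
    evBasis p n ρ hσ a = ev p n σ ρ a.1 (a.2 : ℕ) := by
  rw [evBasis, coe_basisOfLinearIndependentOfCardEqFinrank]

/-- The index of the basis vector `ev p n σ ρ j s`. -/
def evIndex {j : ℕ} (hj : j < p ^ n) (s : ℤ) : Fin (p ^ n) × Fin p :=
  (⟨j, hj⟩, ⟨(s % p).toNat, by
    have := hpp.out.pos
    have := Int.emod_lt_of_pos s (b := p) (by omega)
    omega⟩)

theorem evIndex_modEq {j : ℕ} (hj : j < p ^ n) (s : ℤ) :
    (((evIndex hj s).2 : ℕ) : ℤ) ≡ s [ZMOD p] := by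
  have := hpp.out.pos
  rw [evIndex, Int.toNat_of_nonneg (Int.emod_nonneg _ (by omega))]
  exact Int.mod_modEq _ _

theorem evBasis_evIndex (hσ : σ ≠ 0) {j : ℕ} (hj : j < p ^ n) (s : ℤ) :
    evBasis p n ρ hσ (evIndex hj s) = ev p n σ ρ j s := by
  rw [evBasis_apply]
  exact ev_congr (evIndex_modEq hj s) j

theorem ev_ne_zero (hσ : σ ≠ 0) {j : ℕ} (hj : j < p ^ n) (s : ℤ) : ev p n σ ρ j s ≠ 0 := by
  rw [← evBasis_evIndex hσ hj s]
  exact (evBasis p n ρ hσ).ne_zero _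

theorem linearIndependent_ev_pair (hσ : σ ≠ 0) {j k : ℕ} (hj : j < p ^ n) (hk : k < p ^ n)
    (hjk : j ≠ k) (s : ℤ) : LinearIndependent F ![ev p n σ ρ j s, ev p n σ ρ k s] := by
  have h := (evBasis p n ρ hσ).linearIndependent.comp ![evIndex hj s, evIndex hk s] (by
    have hne : evIndex hj s ≠ evIndex hk s := fun h => hjk (by simpa [evIndex] using h)
    intro a b
    fin_cases a <;> fin_cases b <;> simp [hne, hne.symm])
  convert h using 1
  funext i
  fin_cases i <;> simp [evBasis_evIndex]

end Eigenvectors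

/-! ### The grading over `ℤ/(q-1)pℤ` -/

section Grading

open Ham

variable {F : Type*} [Field F] {p n : ℕ} {σ ρ : F}

/-- The degree of `ev p n σ ρ j s`, the class that is `1 - j` modulo `q - 1` and `s` modulo `p`,
where `q = p^n`.  As `q ≡ 1` modulo `q - 1` and `q ≡ 0` modulo `p`, it is represented by the integer
`(1 - j) q + s (1 - q)`, which depends affinely on `j` and `s`. -/
def evDeg (p n j : ℕ) (s : ℤ) : ZMod ((p ^ n - 1) * p) :=
  (((1 - j) * (p : ℤ) ^ n + s * (1 - (p : ℤ) ^ n) : ℤ) : ZMod ((p ^ n - 1) * p))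

theorem evDeg_add {j k l : ℕ} (h : j + k = l + 1) (s t : ℤ) :
    evDeg p n l (s + t) = evDeg p n j s + evDeg p n k t := by
  rw [evDeg, evDeg, evDeg, ← Int.cast_add]
  congr 1
  have : (j : ℤ) + k = l + 1 := by exact_mod_cast h
  linear_combination (p : ℤ) ^ n * this

theorem evDeg_eq_iff [hpp : Fact p.Prime] (hn : 0 < n) {j : ℕ} {s κ : ℤ} :
    evDeg p n j s = (κ : ZMod ((p ^ n - 1) * p)) ↔
      κ ≡ 1 - j [ZMOD (p : ℤ) ^ n - 1] ∧ κ ≡ s [ZMOD p] := by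
  have h1 : 1 ≤ p ^ n := Nat.one_le_pow _ _ hpp.out.pos
  have hp : (p : ℤ) ∣ (p : ℤ) ^ n := dvd_pow_self _ hn.ne'
  have hcast : ((p ^ n - 1 : ℕ) : ℤ) = (p : ℤ) ^ n - 1 := by push_cast [h1]; ring
  have hcop : ((p ^ n - 1 : ℕ) : ℤ).natAbs.Coprime (p : ℤ).natAbs := by
    rw [Int.natAbs_natCast, Int.natAbs_natCast, Nat.coprime_comm, hpp.out.coprime_iff_not_dvd]
    intro h
    have h' := (Nat.dvd_sub_iff_right h1 (dvd_pow_self p hn.ne')).mp h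
    exact hpp.out.one_lt.ne' (Nat.dvd_one.mp h')
  rw [evDeg, ZMod.intCast_eq_intCast_iff, Nat.cast_mul,
    ← Int.modEq_and_modEq_iff_modEq_mul hcop, hcast]
  have e1 : (1 - j) * (p : ℤ) ^ n + s * (1 - (p : ℤ) ^ n) ≡ 1 - j [ZMOD (p : ℤ) ^ n - 1] :=
    (Int.modEq_iff_dvd.mpr ⟨s - (1 - j), by ring⟩)
  have e2 : (1 - j) * (p : ℤ) ^ n + s * (1 - (p : ℤ) ^ n) ≡ s [ZMOD p] :=
    (Int.modEq_iff_dvd.mpr ((hp.mul_left (s - (1 - j))).trans (dvd_of_eq (by ring))))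
  exact ⟨fun h => ⟨h.1.symm.trans e1, h.2.symm.trans e2⟩,
    fun h => ⟨e1.trans h.1.symm, e2.trans h.2.symm⟩⟩

/-- The component of degree `a` of the grading of `H(2; (1, n); Φ(1))`. -/
def evGrading (p n : ℕ) (σ ρ : F) (a : ZMod ((p ^ n - 1) * p)) : Submodule F (Ham F p 1 n) :=
  Submodule.span F {z | ∃ j, j < p ^ n ∧ ∃ s : ℤ, evDeg p n j s = a ∧ ev p n σ ρ j s = z}

theorem ev_mem_evGrading {j : ℕ} (hj : j < p ^ n) {s : ℤ} {a : ZMod ((p ^ n - 1) * p)}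
    (h : evDeg p n j s = a) : ev p n σ ρ j s ∈ evGrading p n σ ρ a :=
  Submodule.subset_span ⟨j, hj, s, h, rfl⟩

/-- Sorting a basis by degrees decomposes the space. -/
theorem isInternal_span_image {ι κ M : Type*} [DecidableEq κ] [AddCommGroup M] [Module F M]
    (b : Module.Basis ι F M) (d : ι → κ) :
    DirectSum.IsInternal fun k => Submodule.span F (b '' (d ⁻¹' {k})) := by
  refine DirectSum.isInternal_submodule_of_iSupIndep_of_iSup_eq_top ?_ ?_
  · intro k
    refine (b.linearIndependent.disjoint_span_image
      (disjoint_compl_right (a := d ⁻¹' {k}))).mono_right ?_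
    refine iSup₂_le fun l hl => Submodule.span_mono (Set.image_mono ?_)
    intro i hi hi'
    simp only [Set.mem_preimage, Set.mem_singleton_iff] at hi hi'
    exact hl (hi.symm.trans hi')
  · rw [eq_top_iff, ← b.span_eq, Submodule.span_le]
    rintro _ ⟨i, rfl⟩
    exact Submodule.mem_iSup_of_mem (d i) (Submodule.subset_span ⟨i, rfl, rfl⟩)

variable [hpp : Fact p.Prime] [CharP F p]

theorem evGrading_isLieGrading (hp : Odd p) (hn : 0 < n) (hσ : σ ≠ 0)
    (hρ : ρ ^ p - σ ^ (p - 1) * ρ - 1 = 0) : IsLieGrading (evGrading p n σ ρ) where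
  isInternal := by
    have h : evGrading p n σ ρ = fun k => Submodule.span F
        (evBasis p n ρ hσ '' ((fun a => evDeg p n a.1 (a.2 : ℕ)) ⁻¹' {k})) := by
      funext k
      refine le_antisymm (Submodule.span_mono ?_) (Submodule.span_mono ?_)
      · rintro _ ⟨j, hj, s, hd, rfl⟩
        refine ⟨evIndex hj s, ?_, evBasis_evIndex hσ hj s⟩
        obtain ⟨κ, rfl⟩ := ZMod.intCast_surjective k
        obtain ⟨h1, h2⟩ := (evDeg_eq_iff hn).mp hd
        exact (evDeg_eq_iff hn).mpr ⟨h1, h2.trans (evIndex_modEq hj s).symm⟩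
      · rintro _ ⟨a, ha, rfl⟩
        exact ⟨a.1, a.1.isLt, (a.2 : ℕ), ha, (evBasis_apply hσ a).symm⟩
    rw [h]
    exact isInternal_span_image _ _
  bracket_mem a b x hx y hy := by
    unfold evGrading at hx hy
    induction hx, hy using Submodule.span_induction₂ with
    | mem_mem x y hx hy =>
      obtain ⟨j, hj, s, rfl, rfl⟩ := hx
      obtain ⟨k, hk, t, rfl, rfl⟩ := hy
      by_cases h0 : j + k = 0
      · obtain ⟨rfl, rfl⟩ : j = 0 ∧ k = 0 := by omega
        rw [lie_ev_zero_ev_zero]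
        exact zero_mem _
      · obtain ⟨l, hl⟩ : ∃ l, j + k = l + 1 := ⟨j + k - 1, by omega⟩
        rw [lie_ev_ev hp hρ hl hj hk]
        refine Submodule.smul_mem _ _ ?_
        by_cases hlq : l < p ^ n
        · exact ev_mem_evGrading hlq (evDeg_add hl s t)
        · rw [ev_eq_zero (by omega)]
          exact zero_mem _
    | zero_left y _ => simp
    | zero_right x _ => simp
    | add_left x y z _ _ _ h1 h2 => rw [add_lie]; exact add_mem h1 h2
    | add_right x y z _ _ _ h1 h2 => rw [lie_add]; exact add_mem h1 h2
    | smul_left c x y _ _ h => rw [smul_lie]; exact Submodule.smul_mem _ _ h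
    | smul_right c x y _ _ h => rw [lie_smul]; exact Submodule.smul_mem _ _ h

theorem eq_or_of_modEq (hn : 0 < n) {i j : ℕ} (hi : i < p ^ n)
    (hj : j < p ^ n) (h : (1 - i : ℤ) ≡ 1 - j [ZMOD (p : ℤ) ^ n - 1]) :
    i = j ∨ (i = 0 ∧ j = p ^ n - 1) ∨ (i = p ^ n - 1 ∧ j = 0) := by
  have hi' : (i : ℤ) < (p : ℤ) ^ n := by exact_mod_cast hi
  have hj' : (j : ℤ) < (p : ℤ) ^ n := by exact_mod_cast hj
  have hq : ((p ^ n : ℕ) : ℤ) = (p : ℤ) ^ n := by push_cast; rfl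
  obtain ⟨c, hc⟩ := h.dvd
  have h2 : 2 ≤ p ^ n := hpp.out.two_le.trans (Nat.le_self_pow hn.ne' p)
  generalize (p : ℤ) ^ n = q at *
  have hq2 : 2 ≤ q := by omega
  have hc1 : c ≤ 1 := by by_contra! hh; nlinarith
  have hc2 : -1 ≤ c := by by_contra! hh; nlinarith
  interval_cases c <;> omega

/-- The components of degree congruent to `1` modulo `q - 1`. -/
theorem evGrading_of_modEq_one (hn : 0 < n) {κ : ℤ} (hκ : κ ≡ 1 [ZMOD (p : ℤ) ^ n - 1]) :
    evGrading p n σ ρ κ =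
      Submodule.span F {ev p n σ ρ 0 κ, ev p n σ ρ (p ^ n - 1) κ} := by
  have hq : 0 < p ^ n := pow_pos hpp.out.pos _
  refine le_antisymm (Submodule.span_le.mpr ?_) (Submodule.span_le.mpr ?_)
  · rintro _ ⟨j, hj, s, hd, rfl⟩
    obtain ⟨h1, h2⟩ := (evDeg_eq_iff hn).mp hd
    rw [← ev_congr h2]
    refine Submodule.subset_span ?_
    have h3 := eq_or_of_modEq hn hq hj (by simpa using hκ.symm.trans h1)
    rcases h3 with rfl | ⟨_, rfl⟩ | ⟨h, rfl⟩
    · exact Or.inl rfl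
    · exact Or.inr rfl
    · exact Or.inl rfl
  · rintro z (rfl | rfl)
    · exact ev_mem_evGrading hq ((evDeg_eq_iff hn).mpr ⟨by simpa using hκ, rfl⟩)
    · refine ev_mem_evGrading (by omega) ((evDeg_eq_iff hn).mpr ⟨hκ.trans ?_, rfl⟩)
      refine Int.modEq_iff_dvd.mpr ⟨-1, ?_⟩
      push_cast [show 1 ≤ p ^ n from hq]
      ring

/-- The components of degree not congruent to `1` modulo `q - 1`. -/
theorem evGrading_of_modEq (hn : 0 < n) {κ : ℤ} {j : ℕ} (hj1 : 1 ≤ j) (hj : j < p ^ n - 1)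
    (hκ : κ ≡ 1 - j [ZMOD (p : ℤ) ^ n - 1]) :
    evGrading p n σ ρ κ = Submodule.span F {ev p n σ ρ j κ} := by
  refine le_antisymm (Submodule.span_le.mpr ?_) (Submodule.span_le.mpr ?_)
  · rintro _ ⟨i, hi, s, hd, rfl⟩
    obtain ⟨h1, h2⟩ := (evDeg_eq_iff hn).mp hd
    rw [← ev_congr h2]
    refine Submodule.subset_span ?_
    have h3 := eq_or_of_modEq hn hi (by omega) (h1.symm.trans hκ)
    obtain rfl : i = j := by omega
    rfl
  · rintro z rfl
    exact ev_mem_evGrading (by omega) ((evDeg_eq_iff hn).mpr ⟨hκ, rfl⟩)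

theorem exists_modEq_of_not_modEq_one (hp : Odd p) (hn : 0 < n) {κ : ℤ}
    (hκ : ¬ κ ≡ 1 [ZMOD (p : ℤ) ^ n - 1]) :
    ∃ j : ℕ, 1 ≤ j ∧ j < p ^ n - 1 ∧ κ ≡ 1 - j [ZMOD (p : ℤ) ^ n - 1] := by
  have h3 : 3 ≤ p ^ n := three_le_pow hp hn
  have hq : ((p ^ n : ℕ) : ℤ) = (p : ℤ) ^ n := by push_cast; rfl
  have h0 := Int.emod_nonneg (1 - κ) (b := (p : ℤ) ^ n - 1) (by omega)
  have h1 := Int.emod_lt_of_pos (1 - κ) (b := (p : ℤ) ^ n - 1) (by omega)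
  have hmod : κ ≡ 1 - ((((1 - κ) % ((p : ℤ) ^ n - 1)).toNat : ℕ) : ℤ) [ZMOD (p : ℤ) ^ n - 1] := by
    rw [Int.toNat_of_nonneg h0]
    have := (Int.ModEq.refl (n := (p : ℤ) ^ n - 1) 1).sub
      (Int.mod_modEq (1 - κ) ((p : ℤ) ^ n - 1)).symm
    simpa using this
  refine ⟨((1 - κ) % ((p : ℤ) ^ n - 1)).toNat, ?_, by omega, hmod⟩
  by_contra h
  rw [show ((1 - κ) % ((p : ℤ) ^ n - 1)).toNat = 0 by omega] at hmod
  exact hκ (by simpa using hmod)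

theorem evGrading_one (hn : 0 < n) :
    evGrading p n σ ρ 1 = Submodule.span F {genX p n σ ρ, genY p n σ ρ} := by
  have h := evGrading_of_modEq_one (σ := σ) (ρ := ρ) (p := p) hn (κ := 1) rfl
  rwa [Int.cast_one, ev_zero_one, ev_sub_one_one hn] at h

theorem finrank_evGrading_eq_two_iff (hp : Odd p) (hn : 0 < n) (hσ : σ ≠ 0) (κ : ℤ) :
    Module.finrank F (evGrading p n σ ρ κ) = 2 ↔ κ ≡ 1 [ZMOD (p : ℤ) ^ n - 1] := by
  have h3 : 3 ≤ p ^ n := three_le_pow hp hn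
  constructor
  · intro h
    by_contra hκ
    obtain ⟨j, hj1, hj, hmod⟩ := exists_modEq_of_not_modEq_one hp hn hκ
    rw [evGrading_of_modEq hn hj1 hj hmod,
      finrank_span_singleton (ev_ne_zero hσ (j := j) (by omega) _)] at h
    omega
  · intro h
    have hl := linearIndependent_ev_pair (n := n) (p := p) (ρ := ρ) hσ (j := 0) (k := p ^ n - 1)
      (by omega) (by omega) (by omega) κ
    have := finrank_span_eq_card hl
    rwa [Matrix.range_cons_cons_empty, Fintype.card_fin, ← evGrading_of_modEq_one hn h] at this

theorem finrank_evGrading_eq_one (hp : Odd p) (hn : 0 < n) (hσ : σ ≠ 0) {κ : ℤ}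
    (hκ : ¬ κ ≡ 1 [ZMOD (p : ℤ) ^ n - 1]) : Module.finrank F (evGrading p n σ ρ κ) = 1 := by
  obtain ⟨j, hj1, hj, hmod⟩ := exists_modEq_of_not_modEq_one hp hn hκ
  rw [evGrading_of_modEq hn hj1 hj hmod, finrank_span_singleton (ev_ne_zero hσ (j := j) (by omega) _)]

theorem evGrading_ne_bot (hp : Odd p) (hn : 0 < n) (hσ : σ ≠ 0) (a : ZMod ((p ^ n - 1) * p)) :
    evGrading p n σ ρ a ≠ ⊥ := by
  obtain ⟨κ, rfl⟩ := ZMod.intCast_surjective a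
  intro h
  by_cases hκ : κ ≡ 1 [ZMOD (p : ℤ) ^ n - 1]
  · have := (finrank_evGrading_eq_two_iff (ρ := ρ) hp hn hσ κ).mpr hκ
    rw [h, finrank_bot] at this
    omega
  · have := finrank_evGrading_eq_one (ρ := ρ) hp hn hσ hκ
    rw [h, finrank_bot] at this
    omega

/-- The covering property of the grading: all structure constants of `ad X` and `ad Y` between
consecutive components are nonzero, since `ρ ∉ 𝔽_p σ`. -/
theorem evGrading_cyclicCovering (hp : Odd p) (hn : 0 < n)
    (hρ : ρ ^ p - σ ^ (p - 1) * ρ - 1 = 0) : CyclicCovering (evGrading p n σ ρ) := by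
  intro a u hu hu0 w hw
  obtain ⟨κ, rfl⟩ := ZMod.intCast_surjective a
  have h3 : 3 ≤ p ^ n := three_le_pow hp hn
  have hq : ((p ^ n : ℕ) : ℤ) = (p : ℤ) ^ n := by push_cast; rfl
  have hρσ : ρ + σ ≠ 0 := by simpa using add_intCast_mul_ne_zero hρ 1
  have hmem : ∀ c d : F, c • genX p n σ ρ + d • genY p n σ ρ ∈ evGrading p n σ ρ 1 := by
    intro c d
    rw [evGrading_one hn]
    exact Submodule.mem_span_pair.mpr ⟨c, d, rfl⟩
  rw [show ((κ : ZMod ((p ^ n - 1) * p)) + 1) = ((κ + 1 : ℤ) : ZMod _) by push_cast; rfl] at hw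
  by_cases hκ : κ ≡ 1 [ZMOD (p : ℤ) ^ n - 1]
  · rw [evGrading_of_modEq_one hn hκ] at hu
    obtain ⟨c, d, rfl⟩ := Submodule.mem_span_pair.mp hu
    rw [evGrading_of_modEq hn (j := p ^ n - 2) (by omega) (by omega)] at hw
    swap
    · refine (hκ.add_right 1).trans (Int.modEq_iff_dvd.mpr ⟨-1, ?_⟩)
      push_cast [show 2 ≤ p ^ n by omega]
      ring
    obtain ⟨e, rfl⟩ := Submodule.mem_span_singleton.mp hw
    have hX : ⁅c • ev p n σ ρ 0 κ + d • ev p n σ ρ (p ^ n - 1) κ, genX p n σ ρ⁆ =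
        (d * (ρ + σ)) • ev p n σ ρ (p ^ n - 2) (κ + 1) := by
      have := lie_ev_succ_genX (n := n) hp hρ (j := p ^ n - 2) (by omega) κ
      rw [show p ^ n - 2 + 1 = p ^ n - 1 by omega] at this
      rw [add_lie, smul_lie, smul_lie, lie_ev_zero_genX, this, smul_zero, zero_add, smul_smul]
    have hY : ⁅c • ev p n σ ρ 0 κ + d • ev p n σ ρ (p ^ n - 1) κ, genY p n σ ρ⁆ =
        (-(c * (ρ + (κ : F) * σ))) • ev p n σ ρ (p ^ n - 2) (κ + 1) := by
      rw [add_lie, smul_lie, smul_lie, lie_ev_zero_genY hp hn hρ,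
        lie_ev_genY_of_two_le hp hn hρ (by omega) (by omega), smul_zero, add_zero, smul_smul,
        mul_neg]
    by_cases hd : d = 0
    · have hc : c ≠ 0 := by
        rintro rfl
        exact hu0 (by simp [hd])
      refine ⟨_, hmem 0 (-(e / (c * (ρ + (κ : F) * σ)))), ?_⟩
      have := add_intCast_mul_ne_zero hρ κ
      rw [zero_smul, zero_add, lie_smul, hY, smul_smul]
      congr 1
      field_simp
    · refine ⟨_, hmem (e / (d * (ρ + σ))) 0, ?_⟩
      rw [zero_smul, add_zero, lie_smul, hX, smul_smul]
      congr 1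
      field_simp
  · obtain ⟨j, hj1, hj, hmod⟩ := exists_modEq_of_not_modEq_one hp hn hκ
    rw [evGrading_of_modEq hn hj1 hj hmod] at hu
    obtain ⟨c, rfl⟩ := Submodule.mem_span_singleton.mp hu
    have hc : c ≠ 0 := by
      rintro rfl
      exact hu0 (by simp)
    obtain ⟨i, rfl⟩ : ∃ i, j = i + 1 := ⟨j - 1, by omega⟩
    have hmod' : κ + 1 ≡ 1 - i [ZMOD (p : ℤ) ^ n - 1] := by
      have := hmod.add_right 1
      push_cast at this
      simpa [add_comm, sub_eq_add_neg] using this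
    rcases Nat.eq_zero_or_pos i with rfl | hi
    · rw [evGrading_of_modEq_one hn (by simpa using hmod')] at hw
      obtain ⟨d, e, rfl⟩ := Submodule.mem_span_pair.mp hw
      have h2 := two_mul_add_intCast_mul_ne_zero hp hρ (κ + 1)
      refine ⟨_, hmem (d / (c * (ρ + σ))) (e / (c * (2 * ρ + ((κ + 1 : ℤ) : F) * σ))), ?_⟩
      rw [lie_add, lie_smul, lie_smul, smul_lie, smul_lie,
        lie_ev_succ_genX hp hρ (by omega), zero_add, lie_ev_one_genY hp hn hρ]
      simp only [smul_smul]
      congr 2 <;> field_simp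
    · rw [evGrading_of_modEq hn hi (by omega) hmod'] at hw
      obtain ⟨d, rfl⟩ := Submodule.mem_span_singleton.mp hw
      refine ⟨_, hmem (d / (c * (ρ + σ))) 0, ?_⟩
      rw [zero_smul, add_zero, lie_smul, smul_lie, lie_ev_succ_genX hp hρ (by omega)]
      simp only [smul_smul]
      congr 1
      field_simp

/-- The brackets that determine the diamond types, in terms of the degree `κ`. -/
theorem lie_lie_of_mem_evGrading (hp : Odd p) (hn : 0 < n)
    (hρ : ρ ^ p - σ ^ (p - 1) * ρ - 1 = 0) {κ : ℤ} (hκ : κ ≡ 0 [ZMOD (p : ℤ) ^ n - 1])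
    {v : Ham F p 1 n} (hv : v ∈ evGrading p n σ ρ κ) :
    ⁅⁅v, genY p n σ ρ⁆, genY p n σ ρ⁆ = 0 ∧ ⁅⁅v, genX p n σ ρ⁆, genX p n σ ρ⁆ = 0 ∧
      (2 * ρ + ((κ + 1 : ℤ) : F) * σ) • ⁅⁅v, genX p n σ ρ⁆, genY p n σ ρ⁆ =
        (-(ρ + ((κ + 1 : ℤ) : F) * σ)) • ⁅⁅v, genY p n σ ρ⁆, genX p n σ ρ⁆ := by
  have h3 : 3 ≤ p ^ n := three_le_pow hp hn
  rw [evGrading_of_modEq hn le_rfl (by omega) (by simpa using hκ)] at hv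
  obtain ⟨c, rfl⟩ := Submodule.mem_span_singleton.mp hv
  have hX := lie_ev_succ_genX (n := n) hp hρ (j := 0) (by omega) κ
  rw [zero_add] at hX
  have hYX := lie_ev_succ_genX (n := n) hp hρ (j := p ^ n - 2) (by omega) (κ + 1)
  rw [show p ^ n - 2 + 1 = p ^ n - 1 by omega] at hYX
  simp only [smul_lie, hX, lie_ev_one_genY hp hn hρ, lie_ev_zero_genX, lie_ev_zero_genY hp hn hρ,
    lie_ev_genY_of_two_le hp hn hρ (j := p ^ n - 1) (by omega) (by omega), hYX, smul_zero,
    smul_smul, true_and]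
  congr 1
  ring

theorem lie_genY_of_mem_evGrading_two (hp : Odd p) (hn : 0 < n)
    (hρ : ρ ^ p - σ ^ (p - 1) * ρ - 1 = 0) (hq : 3 < p ^ n) {v : Ham F p 1 n}
    (hv : v ∈ evGrading p n σ ρ ((2 : ℤ) : ZMod _)) : ⁅v, genY p n σ ρ⁆ = 0 := by
  have hodd : p ^ n ≠ 4 := fun h => by
    have := (hp.pow (n := n))
    rw [h] at this
    exact absurd this (by decide)
  rw [evGrading_of_modEq hn (j := p ^ n - 2) (by omega) (by omega)
    (Int.modEq_iff_dvd.mpr ⟨-1, by push_cast [show 2 ≤ p ^ n by omega]; ring⟩)] at hv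
  obtain ⟨c, rfl⟩ := Submodule.mem_span_singleton.mp hv
  rw [smul_lie, lie_ev_genY_of_two_le hp hn hρ (by omega) (by omega), smul_zero]

/-- `σ / ρ` is not in the prime field, since it is not a fixed point of the Frobenius map. -/
theorem type_notMem_bot (hσ : σ ≠ 0) (hρ : ρ ^ p - σ ^ (p - 1) * ρ - 1 = 0) :
    -1 + ((3 : F) - 2) * (σ / ρ) ∉ (⊥ : Subfield F) := by
  intro h
  have h1 : σ / ρ ∈ (⊥ : Subfield F) := by
    have := add_mem h (one_mem _)
    rwa [show -1 + ((3 : F) - 2) * (σ / ρ) + 1 = σ / ρ by ring] at this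
  have h2 : (⊥ : Subfield F) ≤ (frobenius F p).eqLocusField (RingHom.id F) := bot_le
  have h4 : (σ / ρ) ^ p = σ / ρ := h2 h1
  have hρ0 := rho_ne_zero hρ
  rw [div_pow, div_eq_div_iff (pow_ne_zero _ hρ0) hρ0] at h4
  have h5 : σ ^ p = σ ^ (p - 1) * σ := by
    rw [← pow_succ, Nat.sub_add_cancel hpp.out.one_le]
  rw [h5] at h4
  exact hσ (by linear_combination -σ * hρ - h4)

end Grading

/-! ### Brackets in the loop algebra and diamond types -/

section Diamonds

open Ham Polynomial

theorem coe_lie_loopGen {F L : Type*} [Field F] [LieRing L] [LieAlgebra F L] {U : Submodule F L}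
    {k : ℕ} {V : loopAlgebra U} {v : L} (hV : (V : F[X] ⊗[F] L) = (X ^ k) ⊗ₜ[F] v) {x : L}
    (hx : x ∈ U) : (⁅V, loopGen U x hx⁆ : loopAlgebra U) = (X ^ (k + 1) : F[X]) ⊗ₜ[F] ⁅v, x⁆ := by
  change ⁅(V : F[X] ⊗[F] L), X ⊗ₜ[F] x⁆ = _
  rw [hV, LieAlgebra.ExtendScalars.bracket_tmul, pow_succ]

theorem smul_eq_smul_of_tmul {F L : Type*} [Field F] [LieRing L] [LieAlgebra F L]
    {U : Submodule F L} {f : F[X]} {V W : loopAlgebra U} {v w : L} {c d : F}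
    (hV : (V : F[X] ⊗[F] L) = f ⊗ₜ[F] v) (hW : (W : F[X] ⊗[F] L) = f ⊗ₜ[F] w)
    (h : c • v = d • w) : c • V = d • W := by
  refine Subtype.ext ?_
  change c • (V : F[X] ⊗[F] L) = d • (W : F[X] ⊗[F] L)
  rw [hV, hW, ← TensorProduct.tmul_smul, ← TensorProduct.tmul_smul, h]

variable {F : Type*} [Field F] {p n : ℕ} {σ ρ : F} [hpp : Fact p.Prime] [CharP F p]

/-- The relations in the loop algebra that define the type of the diamond in degree `k + 1`, for
`k` divisible by `q - 1`. -/
theorem lie_lie_of_mem_loopComponent (hp : Odd p) (hn : 0 < n) (hσ : σ ≠ 0)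
    (hρ : ρ ^ p - σ ^ (p - 1) * ρ - 1 = 0)
    (hX : genX p n σ ρ ∈ evGrading p n σ ρ 1) (hY : genY p n σ ρ ∈ evGrading p n σ ρ 1)
    (m : ℕ) {V : loopAlgebra (evGrading p n σ ρ 1)}
    (hV : V ∈ loopComponent (evGrading p n σ ρ 1) (m * (p ^ n - 1))) :
    ⁅⁅V, loopGen _ _ hY⁆, loopGen _ _ hY⁆ = 0 ∧ ⁅⁅V, loopGen _ _ hX⁆, loopGen _ _ hX⁆ = 0 ∧
      (1 - (-1 + ((m : F) - 1) * (σ / ρ))) • ⁅⁅V, loopGen _ _ hX⁆, loopGen _ _ hY⁆ =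
        (-1 + ((m : F) - 1) * (σ / ρ)) • ⁅⁅V, loopGen _ _ hY⁆, loopGen _ _ hX⁆ := by
  have h3 : 3 ≤ p ^ n := three_le_pow hp hn
  have hρ0 := rho_ne_zero hρ
  have hV' := eq_tmul_loopCoeff hV
  have hv := loopCoeff_mem (evGrading_isLieGrading hp hn hσ hρ) V.2 (m * (p ^ n - 1))
  generalize loopCoeff (m * (p ^ n - 1)) V.1 = v at hV' hv
  have hκ : ((m * (p ^ n - 1) : ℕ) : ℤ) ≡ 0 [ZMOD (p : ℤ) ^ n - 1] := by
    refine Int.modEq_iff_dvd.mpr ⟨-m, ?_⟩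
    push_cast [show 1 ≤ p ^ n by omega]
    ring
  rw [← Int.cast_natCast (m * (p ^ n - 1))] at hv
  obtain ⟨hYY, hXX, hXY⟩ := lie_lie_of_mem_evGrading hp hn hρ hκ hv
  have hcast : (((m * (p ^ n - 1) : ℕ) + 1 : ℤ) : F) = 1 - m := by
    rw [Int.cast_add, Int.cast_natCast, Nat.cast_mul, natCast_pow_sub_one hn]
    push_cast
    ring
  rw [hcast] at hXY
  have key : ∀ {x y : Ham F p 1 n} (hx : x ∈ evGrading p n σ ρ 1) (hy : y ∈ evGrading p n σ ρ 1),
      (⁅⁅V, loopGen _ _ hx⁆, loopGen _ _ hy⁆ : loopAlgebra (evGrading p n σ ρ 1)) =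
        (X ^ (m * (p ^ n - 1) + 1 + 1) : F[X]) ⊗ₜ[F] ⁅⁅v, x⁆, y⁆ := fun hx hy =>
    coe_lie_loopGen (coe_lie_loopGen hV' hx) hy
  refine ⟨Subtype.ext ?_, Subtype.ext ?_,
    smul_eq_smul_of_tmul (key hX hY) (key hY hX) ?_⟩
  · rw [key hY hY, hYY, TensorProduct.tmul_zero]; rfl
  · rw [key hX hX, hXX, TensorProduct.tmul_zero]; rfl
  · have h1 : 1 - (-1 + ((m : F) - 1) * (σ / ρ)) = ρ⁻¹ * (2 * ρ + (1 - m) * σ) := by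
      field_simp; ring
    have h2 : -1 + ((m : F) - 1) * (σ / ρ) = ρ⁻¹ * -(ρ + (1 - m) * σ) := by
      field_simp; ring
    rw [h1, h2, mul_smul, hXY, mul_smul]

theorem finrank_loopComponent_eq_two_iff (hp : Odd p) (hn : 0 < n) (hσ : σ ≠ 0)
    (hρ : ρ ^ p - σ ^ (p - 1) * ρ - 1 = 0) {i : ℕ} (hi : 1 ≤ i) :
    Module.finrank F (loopComponent (evGrading p n σ ρ 1) i) = 2 ↔ i ≡ 1 [MOD p ^ n - 1] := by
  rw [finrank_loopComponent (evGrading_isLieGrading hp hn hσ hρ)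
    (evGrading_cyclicCovering hp hn hρ) (evGrading_ne_bot hp hn hσ) hi,
    ← Int.cast_natCast i, finrank_evGrading_eq_two_iff hp hn hσ, ← Int.natCast_modEq_iff]
  push_cast [Nat.one_le_pow n p hpp.out.pos]
  rfl

theorem finrank_loopComponent_eq_one (hp : Odd p) (hn : 0 < n) (hσ : σ ≠ 0)
    (hρ : ρ ^ p - σ ^ (p - 1) * ρ - 1 = 0) {i : ℕ} (hi : 1 ≤ i) (h : ¬ i ≡ 1 [MOD p ^ n - 1]) :
    Module.finrank F (loopComponent (evGrading p n σ ρ 1) i) = 1 := by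
  rw [finrank_loopComponent (evGrading_isLieGrading hp hn hσ hρ)
    (evGrading_cyclicCovering hp hn hρ) (evGrading_ne_bot hp hn hσ) hi, ← Int.cast_natCast i]
  refine finrank_evGrading_eq_one hp hn hσ fun h' => h ?_
  rw [← Int.natCast_modEq_iff]
  push_cast [Nat.one_le_pow n p hpp.out.pos]
  exact h'

theorem isDiamondOfType_loopComponent (hp : Odd p) (hn : 0 < n) (hσ : σ ≠ 0)
    (hρ : ρ ^ p - σ ^ (p - 1) * ρ - 1 = 0)
    (hX : genX p n σ ρ ∈ evGrading p n σ ρ 1) (hY : genY p n σ ρ ∈ evGrading p n σ ρ 1)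
    {t : ℕ} (ht : 2 ≤ t) :
    IsDiamondOfType (loopComponent (evGrading p n σ ρ 1)) (loopGen _ _ hX) (loopGen _ _ hY)
      ((t - 1) * (p ^ n - 1) + 1) (-1 + ((t : F) - 2) * (σ / ρ)) := by
  have h3 : 3 ≤ p ^ n := three_le_pow hp hn
  obtain ⟨m, rfl⟩ : ∃ m, t = m + 1 := ⟨t - 1, by omega⟩
  rw [Nat.add_sub_cancel]
  have hpos : 1 ≤ m * (p ^ n - 1) := Nat.mul_pos (by omega) (by omega)
  refine ⟨by omega, ?_, ?_, ?_⟩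
  · refine (finrank_loopComponent_eq_two_iff hp hn hσ hρ (by omega)).mpr ?_
    simp [Nat.ModEq, Nat.add_mod]
  · rw [Nat.add_sub_cancel]
    refine finrank_loopComponent_eq_one hp hn hσ hρ hpos fun h => ?_
    rw [Nat.ModEq, Nat.mul_mod_left, Nat.mod_eq_of_lt (by omega)] at h
    omega
  · rw [Nat.add_sub_cancel, show ((m + 1 : ℕ) : F) - 2 = m - 1 by push_cast; ring]
    exact fun V hV => lie_lie_of_mem_loopComponent hp hn hσ hρ hX hY m hV

theorem secondDiamondIn_loopComponent (hp : Odd p) (hn : 0 < n) (hσ : σ ≠ 0)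
    (hρ : ρ ^ p - σ ^ (p - 1) * ρ - 1 = 0) :
    SecondDiamondIn (loopComponent (evGrading p n σ ρ 1)) (p ^ n) := by
  have h3 : 3 ≤ p ^ n := three_le_pow hp hn
  refine ⟨by omega, (finrank_loopComponent_eq_two_iff hp hn hσ hρ (by omega)).mpr ?_, ?_⟩
  · exact ((Nat.modEq_iff_dvd' (by omega)).mpr dvd_rfl).symm
  · intro i hi hiq h
    have h1 := (finrank_loopComponent_eq_two_iff hp hn hσ hρ (by omega)).mp h
    have h2 := Nat.le_of_dvd (by omega) ((Nat.modEq_iff_dvd' (by omega)).mp h1.symm)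
    omega

theorem isDistinguishedPair_loopComponent (hp : Odd p) (hn : 0 < n) (hσ : σ ≠ 0)
    (hρ : ρ ^ p - σ ^ (p - 1) * ρ - 1 = 0)
    (hX : genX p n σ ρ ∈ evGrading p n σ ρ 1) (hY : genY p n σ ρ ∈ evGrading p n σ ρ 1) :
    IsDistinguishedPair (loopComponent (evGrading p n σ ρ 1)) (p ^ n)
      (loopGen _ _ hX) (loopGen _ _ hY) where
  X_mem := ⟨genX p n σ ρ, by rw [pow_one]; rfl⟩
  Y_mem := ⟨genY p n σ ρ, by rw [pow_one]; rfl⟩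
  linearIndependent := by
    have h3 : 3 ≤ p ^ n := three_le_pow hp hn
    have h := linearIndependent_ev_pair (n := n) (p := p) (ρ := ρ) hσ (j := 0) (k := p ^ n - 1)
      (by omega) (by omega) (by omega) 1
    rw [ev_zero_one, ev_sub_one_one hn] at h
    refine LinearIndependent.of_comp
      (loopCoeff 1 ∘ₗ (loopAlgebra (evGrading p n σ ρ 1)).toSubmodule.subtype) ?_
    have hc : ∀ x (hx : x ∈ evGrading p n σ ρ 1),
        loopCoeff 1 (loopGen (evGrading p n σ ρ 1) x hx).1 = x := by
      intro x hx
      have := loopCoeff_tmul (F := F) 1 1 x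
      rwa [pow_one, if_pos rfl] at this
    have he : ⇑(loopCoeff 1 ∘ₗ (loopAlgebra (evGrading p n σ ρ 1)).toSubmodule.subtype) ∘
        ![loopGen _ _ hX, loopGen _ _ hY] = ![genX p n σ ρ, genY p n σ ρ] := by
      funext i
      fin_cases i
      · exact hc _ hX
      · exact hc _ hY
    rw [he]
    exact h
  centralizer hq w hw := by
    have hw' := eq_tmul_loopCoeff hw
    have hv := loopCoeff_mem (evGrading_isLieGrading hp hn hσ hρ) w.2 2
    refine Subtype.ext ?_
    rw [coe_lie_loopGen hw' hY, lie_genY_of_mem_evGrading_two hp hn hρ hq (by exact_mod_cast hv),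
      TensorProduct.tmul_zero]
    rfl
  rel V hV := by
    obtain ⟨hYY, hXX, hXY⟩ := lie_lie_of_mem_loopComponent hp hn hσ hρ hX hY 1
      (by rwa [one_mul])
    refine ⟨hXX, hYY, ?_⟩
    rw [Nat.cast_one, sub_self, zero_mul, add_zero, sub_neg_eq_add, one_add_one_eq_two, neg_smul,
      one_smul] at hXY
    rw [neg_smul, hXY, neg_neg]

end Diamonds

end AlbertZassenhaus

end

open AlbertZassenhaus in
theorem mainTheorem1 {F : Type*} [Field F] {p : ℕ} [Fact p.Prime] [CharP F p] (hp : Odd p)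
    (n : ℕ) (hn : 0 < n) (σ ρ : F) (hσ : σ ≠ 0) (hρ : ρ ^ p - σ ^ (p - 1) * ρ - 1 = 0) :
    -- `X` and `Y` are members of the family `e_{1-j, α}`, with `π = σ^(p-1)`
    Ham.eigvec p 1 n (σ ^ (p - 1)) 0 (ρ + σ) = Ham.genX p n σ ρ ∧
    Ham.eigvec p 1 n (σ ^ (p - 1)) (p ^ n - 1) (2 * ρ + σ) = Ham.genY p n σ ρ ∧
    -- the `e_{1-j, α}`, `0 ≤ j < q`, `α ∈ (1 - j) ρ + 𝔽_p σ`, form a basis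
    (∃ b : Module.Basis (Fin (p ^ n) × Fin p) F (Ham F p 1 n), ∀ (j : Fin (p ^ n)) (s : Fin p),
      b (j, s) = Ham.eigvec p 1 n (σ ^ (p - 1)) (j : ℕ)
        ((1 - ((j : ℕ) : F)) * ρ + ((s : ℕ) : F) * σ)) ∧
    -- of eigenvectors for `ad e₀`
    (∀ (j : ℕ) (s : ℤ), j < p ^ n →
      ⁅Ham.e₀ p 1 n (σ ^ (p - 1)),
        Ham.eigvec p 1 n (σ ^ (p - 1)) j ((1 - (j : F)) * ρ + (s : F) * σ)⁆ =
      ((1 - (j : F)) * ρ + (s : F) * σ) •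
        Ham.eigvec p 1 n (σ ^ (p - 1)) j ((1 - (j : F)) * ρ + (s : F) * σ)) ∧
    -- `X` and `Y` generate
    LieSubalgebra.lieSpan F (Ham F p 1 n) {Ham.genX p n σ ρ, Ham.genY p n σ ρ} = ⊤ ∧
    -- the grading, and its uniqueness
    ∃ (𝓖 : ZMod ((p ^ n - 1) * p) → Submodule F (Ham F p 1 n))
      (hX : Ham.genX p n σ ρ ∈ 𝓖 1) (hY : Ham.genY p n σ ρ ∈ 𝓖 1),
      IsLieGrading 𝓖 ∧
      (∀ 𝓖' : ZMod ((p ^ n - 1) * p) → Submodule F (Ham F p 1 n), IsLieGrading 𝓖' →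
        Ham.genX p n σ ρ ∈ 𝓖' 1 → Ham.genY p n σ ρ ∈ 𝓖' 1 → 𝓖' = 𝓖) ∧
      -- the degree `k` of `e_{r, rρ+sσ}`, `r = 1 - j`
      (∀ (j : ℕ) (s k : ℤ), j < p ^ n →
        k ≡ 1 - (j : ℤ) [ZMOD ((p : ℤ) ^ n - 1)] → k ≡ s [ZMOD (p : ℤ)] →
        Ham.eigvec p 1 n (σ ^ (p - 1)) j ((1 - (j : F)) * ρ + (s : F) * σ) ∈ 𝓖 k) ∧
      -- the loop algebra
      IsThin (loopComponent (𝓖 1)) ∧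
      SecondDiamondIn (loopComponent (𝓖 1)) (p ^ n) ∧
      (∀ i : ℕ, 1 ≤ i →
        (Module.finrank F (loopComponent (𝓖 1) i) = 2 ↔ i ≡ 1 [MOD (p ^ n - 1)])) ∧
      IsDistinguishedPair (loopComponent (𝓖 1)) (p ^ n)
        (loopGen (𝓖 1) (Ham.genX p n σ ρ) hX) (loopGen (𝓖 1) (Ham.genY p n σ ρ) hY) ∧
      (∀ t : ℕ, 2 ≤ t → IsDiamondOfType (loopComponent (𝓖 1))
        (loopGen (𝓖 1) (Ham.genX p n σ ρ) hX) (loopGen (𝓖 1) (Ham.genY p n σ ρ) hY)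
        ((t - 1) * (p ^ n - 1) + 1) (-1 + ((t : F) - 2) * (σ / ρ))) ∧
      -- the type of the third diamond is not in the prime field
      -1 + ((3 : F) - 2) * (σ / ρ) ∉ (⊥ : Subfield F) := by
  have h3 : 3 ≤ p ^ n := three_le_pow hp hn
  have : NeZero ((p ^ n - 1) * p) :=
    ⟨Nat.mul_ne_zero (by omega) (Fact.out : p.Prime).ne_zero⟩
  have h𝓖 := evGrading_isLieGrading hp hn hσ hρ
  have hcov := evGrading_cyclicCovering hp hn hρ
  have hne := evGrading_ne_bot (ρ := ρ) hp hn hσ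
  have hX : Ham.genX p n σ ρ ∈ evGrading p n σ ρ 1 := by
    rw [evGrading_one hn]
    exact Submodule.subset_span (Or.inl rfl)
  have hY : Ham.genY p n σ ρ ∈ evGrading p n σ ρ 1 := by
    rw [evGrading_one hn]
    exact Submodule.subset_span (Or.inr rfl)
  refine ⟨eigvec_eq_genX, eigvec_eq_genY hn, ⟨evBasis p n ρ hσ, fun j s => ?_⟩,
    fun j s hj => lie_e₀_ev hp hn hρ hj s, hcov.lieSpan_eq_top h𝓖 hne (evGrading_one hn),
    evGrading p n σ ρ, hX, hY, h𝓖, fun 𝓖' h𝓖' hX' hY' => ?_, fun j s k hj hk1 hk2 => ?_,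
    loopComponent_isThin h𝓖 hcov hne ?_, secondDiamondIn_loopComponent hp hn hσ hρ,
    fun i hi => finrank_loopComponent_eq_two_iff hp hn hσ hρ hi,
    isDistinguishedPair_loopComponent hp hn hσ hρ hX hY,
    fun t ht => isDiamondOfType_loopComponent hp hn hσ hρ hX hY ht, type_notMem_bot hσ hρ⟩
  · rw [evBasis_apply, ev, Int.cast_natCast]
  · refine hcov.eq_of_isLieGrading h𝓖 hne h𝓖' ?_
    rw [evGrading_one hn, Submodule.span_le]
    rintro z (rfl | rfl)
    exacts [hX', hY']
  · exact ev_mem_evGrading hj ((evDeg_eq_iff hn).mpr ⟨hk1, hk2⟩)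
  · have := (finrank_evGrading_eq_two_iff (ρ := ρ) hp hn hσ 1).mpr rfl
    rwa [Int.cast_one] at this
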